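/- Let $T>0$. Let $C[0,\infty)$ be the space of continuous paths $[0,\infty)\to\mathbb R$ with the topology of uniform convergence on compacts, let $D^{\uparrow}[0,T]$ be the space of non-negative, non-decreasing càdlàg paths on $[0,T]$ with Skorokhod's $M_1$ topology, and let $D^\circ[0,T]=C[0,\infty)\times D^{\uparrow}[0,T]$ carry the product topology and its Borel $\sigma$-algebra. For $\tau\in D^{\uparrow}[0,T]$ write $\Delta\tau(t)=\tau(t)-\tau(t-)$, with $\tau(0-)=\tau(0)$. For each $n\ge 1$ let $Z^n=(Z^n_t)_{t\ge0}$ be a continuous real-valued martingale on a filtered probability space $(\Omega^n,\mathcal F^n,(\mathcal F^n_t)_{t\ge 0},\mathbb P^n)$, and let $A^n=(A^n_t)_{t\in[0,T]}$ be a process with paths in $D^{\uparrow}[0,T]$ such that $A^n_0=0$ almost surely and each $A^n_t$, $t\in[0,T]$, is an $(\mathcal F^n_s)_{s\geq 0}$-stopping time. Assume that the jumps of $A^n$ vanish uniformly in probability, i.e. $\mathbb P^n\bigl(\sup_{t\in[0,T]}\Delta A^n_t>\varepsilon\bigr)\to0$ as $n\to\infty$ for every $\varepsilon>0$ (this holds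 trivially if the $A^n$ are continuous). Let $(Z,A)$ be a random element of $D^\circ[0,T]$ such that $(Z^n,A^n)\Rightarrow(Z,A)$ weakly in $D^\circ[0,T]$, and assume that $$\sup_{n\ge1}\mathbb E\Bigl[\sup_{t\in[0,T]}\bigl|Z^n_{A^n_t}\bigr|\Bigr]<\infty .$$ Then $M_t:=Z_{A_t}$, $t\in[0,T]$, is a martingale with respect to its own filtration $\sigma(M_r:r\le t)$, and $$\mathbb E\Bigl[\sup_{0\le s\le A_T}|Z_s|\Bigr]<\infty .$$ -/

import Mathlib

open MeasureTheory ProbabilityTheory Filter Topology Set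
open scoped NNReal ENNReal

noncomputable section

/-- `x` is càdlàg on `[0,T]`: right-continuous with left limits. (At the endpoints the one-sided
conditions that do not make sense are vacuous.) -/
def IsCadlag {T : ℝ} {E : Type*} [TopologicalSpace E] (x : Icc (0 : ℝ) T → E) : Prop :=
  ∀ t, ContinuousWithinAt x (Ici t) t ∧ ∃ l, Tendsto x (𝓝[<] t) (𝓝 l)

/-- The completed graph `{(z,t) : z ∈ [x(t-), x(t)]}` of a path, where `[a,b]` is the segment
between `a` and `b` and `x(0-) = x(0)`. -/
def completedGraph {T : ℝ} (x : Icc (0 : ℝ) T → ℝ) : Set (ℝ × Icc (0 : ℝ) T) :=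
  {p | p.1 ∈ segment ℝ (Function.leftLim x p.2) (x p.2)}

/-- The order on the completed graph: first by time, and at equal times by the distance
to the left limit `x(t-)`. -/
def GraphLE {T : ℝ} (x : Icc (0 : ℝ) T → ℝ) (p q : ℝ × Icc (0 : ℝ) T) : Prop :=
  p.2 < q.2 ∨ (p.2 = q.2 ∧
    |Function.leftLim x p.2 - p.1| ≤ |Function.leftLim x q.2 - q.1|)

/-- A parametric representation of `x`: a continuous map `s ↦ (u(s), r(s))` of `[0,1]` onto the
completed graph of `x` which is nondecreasing for the order of the graph. -/
def IsParametricRep {T : ℝ} (x : Icc (0 : ℝ) T → ℝ) (p : C(unitInterval, ℝ × Icc (0 : ℝ) T)) :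
    Prop :=
  range p = completedGraph x ∧ ∀ s s', s ≤ s' → GraphLE x (p s) (p s')

/-- Skorokhod's `M₁` distance: the infimum over parametric representations `(u₁,r₁)` of `x` and
`(u₂,r₂)` of `y` of `max (‖u₁ - u₂‖_∞, ‖r₁ - r₂‖_∞)` (products carry the maximum distance). -/
def m1Dist {T : ℝ} (x y : Icc (0 : ℝ) T → ℝ) : ℝ≥0∞ :=
  ⨅ (p : C(unitInterval, ℝ × Icc (0 : ℝ) T)) (_ : IsParametricRep x p)
    (q : C(unitInterval, ℝ × Icc (0 : ℝ) T)) (_ : IsParametricRep y q),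
    ⨆ s : unitInterval, edist (p s) (q s)

/-- `D^↑[0,T]`: non-negative, non-decreasing càdlàg paths on `[0,T]`. -/
def DUp (T : ℝ) : Type :=
  {x : Icc (0 : ℝ) T → ℝ≥0 // IsCadlag x ∧ Monotone x}

instance (T : ℝ) : CoeFun (DUp T) (fun _ => Icc (0 : ℝ) T → ℝ≥0) := ⟨Subtype.val⟩

/-- A path of `D^↑[0,T]` as a real-valued path. -/
def DUp.toReal {T : ℝ} (x : DUp T) : Icc (0 : ℝ) T → ℝ := fun t => (x t : ℝ)

/-- The `M₁` topology on `D^↑[0,T]`, i.e. the topology of the `M₁` distance: a set is open if with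
every point it contains an `M₁` ball around that point. -/
instance (T : ℝ) : TopologicalSpace (DUp T) where
  IsOpen U := ∀ x ∈ U, ∃ ε : ℝ≥0∞, 0 < ε ∧ ∀ y : DUp T, m1Dist x.toReal y.toReal < ε → y ∈ U
  isOpen_univ := fun _ _ => ⟨1, one_pos, fun _ _ => mem_univ _⟩
  isOpen_inter := by
    rintro U V hU hV x ⟨hxU, hxV⟩
    obtain ⟨ε, hε, h⟩ := hU x hxU
    obtain ⟨δ, hδ, h'⟩ := hV x hxV
    exact ⟨min ε δ, lt_min hε hδ, fun y hy =>
      ⟨h y (hy.trans_le (min_le_left _ _)), h' y (hy.trans_le (min_le_right _ _))⟩⟩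
  isOpen_sUnion := by
    rintro S hS x ⟨U, hU, hx⟩
    obtain ⟨ε, hε, h⟩ := hS U hU x hx
    exact ⟨ε, hε, fun y hy => ⟨U, hU, h y hy⟩⟩

/-- `D^∘[0,T]`: pairs of a path `φ ∈ C[0,∞)` and a time change `τ ∈ D^↑[0,T]`. -/
def DCirc (T : ℝ) : Type := C(ℝ≥0, ℝ) × DUp T

/-- The product of the topology of uniform convergence on compacts and the `M₁` topology. -/
instance (T : ℝ) : TopologicalSpace (DCirc T) :=
  inferInstanceAs (TopologicalSpace (C(ℝ≥0, ℝ) × DUp T))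

/-- The Borel `σ`-algebra. -/
instance (T : ℝ) : MeasurableSpace (DCirc T) := borel _

instance (T : ℝ) : BorelSpace (DCirc T) := ⟨rfl⟩

/-- The pair `(φ, τ)` as an element of `D^∘[0,T]`. -/
def DCirc.mk {T : ℝ} (φ : C(ℝ≥0, ℝ)) (τ : DUp T) : DCirc T := (φ, τ)

/-- The jump `τ(t) - τ(t-)` (equal to `0` at `t = 0`). -/
def DUp.jump {T : ℝ} (τ : DUp T) (t : Icc (0 : ℝ) T) : ℝ :=
  τ.toReal t - Function.leftLim τ.toReal t

/-- `M` is a martingale with respect to its own filtration `σ(M_r : r ≤ t)`. -/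
def IsMartingaleOwnFiltration {ι Ω : Type*} [Preorder ι] [MeasurableSpace Ω]
    (M : ι → Ω → ℝ) (P : Measure Ω) : Prop :=
  ∃ hM : ∀ t, StronglyMeasurable (M t), Martingale M (Filtration.natural M hM) P

end

/-! The sampled processes `Z^n_{A^n}` are not assumed uniformly integrable, so the martingale
property cannot be passed to the limit directly. The proof truncates at a level `L`, controls the
resulting error before the limit, and removes it only afterwards, where integrability of `S = sup_{s
≤ A_T} |Z_s|` is available.

Integrability of `S`: the functional `S` is continuous on `D^∘`, because `τ ↦ τ(T)` is
M₁-continuous. The assumed bound only sees `|Z^n|` on the range of `A^n`; but a gap in that range is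
a jump of `A^n`, so `S^n` exceeds the supremum over the range by at most an oscillation of `Z^n`
over distances bounded by the jumps (`DUp.supNorm_le`). Vanishing jumps, weak convergence and
Fatou's lemma give `E S < ∞` (`lintegral_pathSup_le`).

Martingale property: let `α ≤ β` be stopping times and `|G| ≤ 1` measurable at `α`. Stopping `Z^n`
when `|Z^n|` reaches `L` gives an increment orthogonal to `G`, which agrees with the truncated
increment unless the supremum up to `β` reaches `L`. Hence the truncated increment is orthogonal to
`G` up to `4 L P(S^n ≥ L)` (`abs_integral_truncate_sub_mul_le`). In the limit this error is at most
`4 L E[ramp_L(S)]`, which tends to `0` as `L → ∞` since `S` is integrable.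

Evaluation of `τ` at a fixed time is not M₁-continuous, but averages over time windows are
(`DUp.continuous_average`). Weak convergence is therefore applied to averaged increments;
right-continuity removes the averaging. -/

/-! ### M₁ convergence of non-decreasing paths -/

namespace DUp

variable {T : ℝ}

theorem monotone_toReal (x : DUp T) : Monotone x.toReal := fun _ _ h =>
  NNReal.coe_le_coe.2 (x.2.2 h)

theorem mem_completedGraph_self (x : Icc (0 : ℝ) T → ℝ) (t : Icc (0 : ℝ) T) :
    (x t, t) ∈ completedGraph x := right_mem_segment _ _ _

theorem mem_completedGraph_iff (x : DUp T) (p : ℝ × Icc (0 : ℝ) T) :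
    p ∈ completedGraph x.toReal ↔
      Function.leftLim x.toReal p.2 ≤ p.1 ∧ p.1 ≤ x.toReal p.2 := by
  unfold completedGraph
  rw [mem_ofPred_eq, segment_eq_Icc (x.monotone_toReal.leftLim_le le_rfl), mem_Icc]

/-- Parametric representations are onto, so each point of one graph is matched with a δ-close point
of the other. All that is needed of the M₁ distance is contained in these inequalities. -/
theorem exists_near_of_m1Dist_lt {x y : DUp T} {δ : ℝ}
    (h : m1Dist x.toReal y.toReal < ENNReal.ofReal δ) :
    (∀ t, ∃ r, dist r t < δ ∧ y.toReal t < x.toReal r + δ ∧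
      Function.leftLim x.toReal r < y.toReal t + δ) ∧
    ∀ t, ∃ r, x.toReal t < y.toReal r + δ := by
  unfold m1Dist at h
  simp only [iInf_lt_iff] at h
  obtain ⟨p, hp, q, hq, h⟩ := h
  have hd : ∀ s, dist (p s) (q s) < δ := fun s => by
    have := (le_iSup (fun s => edist (p s) (q s)) s).trans_lt h
    rw [edist_dist] at this
    exact (ENNReal.ofReal_lt_ofReal_iff_of_nonneg dist_nonneg).1 this
  constructor
  · intro t
    obtain ⟨s, hs⟩ : (y.toReal t, t) ∈ range q := hq.1 ▸ mem_completedGraph_self _ t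
    have hps : p s ∈ completedGraph x.toReal := hp.1 ▸ mem_range_self s
    rw [mem_completedGraph_iff] at hps
    have h1 := hd s
    rw [hs, Prod.dist_eq, max_lt_iff, Real.dist_eq, abs_lt] at h1
    exact ⟨(p s).2, h1.2, by linarith, by linarith⟩
  · intro t
    obtain ⟨s, hs⟩ : (x.toReal t, t) ∈ range p := hp.1 ▸ mem_completedGraph_self _ t
    have hqs : q s ∈ completedGraph y.toReal := hq.1 ▸ mem_range_self s
    rw [mem_completedGraph_iff] at hqs
    have h1 := hd s
    rw [hs, Prod.dist_eq, max_lt_iff, Real.dist_eq, abs_lt] at h1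
    exact ⟨(q s).2, by linarith⟩

/-- Open sets are defined through balls, so testing the radii `1/(n+1)` suffices; neither symmetry
nor the triangle inequality for `m1Dist` enters. -/
theorem continuous_of_m1Dist {X : Type*} [TopologicalSpace X] {f : DUp T → X}
    (h : ∀ (x : DUp T) (y : ℕ → DUp T),
      (∀ n : ℕ, m1Dist x.toReal (y n).toReal < ENNReal.ofReal (1 / ((n : ℝ) + 1))) →
      Tendsto (fun n => f (y n)) atTop (𝓝 (f x))) : Continuous f := by
  refine continuous_def.2 fun U hU x hx => ?_
  by_contra! hcon
  have hpos : ∀ n : ℕ, 0 < ENNReal.ofReal (1 / ((n : ℝ) + 1)) := fun n =>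
    ENNReal.ofReal_pos.2 (by positivity)
  choose y hy hyU using fun n : ℕ => hcon _ (hpos n)
  obtain ⟨n, hn⟩ := ((h x y hy).eventually (hU.mem_nhds hx)).exists
  exact hyU n hn

/-- The matched times `r n` tend to `t`. The upper bound is continuity of `x` at `t`; for the lower
bound, left limits at `r n` eventually dominate `x d` for a fixed `d < t` close to `t`. -/
theorem tendsto_of_m1Dist {x : DUp T} {y : ℕ → DUp T}
    (h : ∀ n : ℕ, m1Dist x.toReal (y n).toReal < ENNReal.ofReal (1 / ((n : ℝ) + 1)))
    {t : Icc (0 : ℝ) T} (ht : ContinuousAt x.toReal t) :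
    Tendsto (fun n => (y n).toReal t) atTop (𝓝 (x.toReal t)) := by
  have hlim : Tendsto (fun n : ℕ => 1 / ((n : ℝ) + 1)) atTop (𝓝 0) :=
    tendsto_one_div_add_atTop_nhds_zero_nat
  choose r hr hyr hry using fun n => (exists_near_of_m1Dist_lt (h n)).1 t
  have hrt : Tendsto r atTop (𝓝 t) :=
    tendsto_iff_dist_tendsto_zero.2
      (squeeze_zero (fun _ => dist_nonneg) (fun n => (hr n).le) hlim)
  have hx : Tendsto (fun n => x.toReal (r n)) atTop (𝓝 (x.toReal t)) := ht.tendsto.comp hrt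
  refine tendsto_order.2 ⟨fun a ha => ?_, fun a ha => ?_⟩
  · obtain ⟨b, hab, hb⟩ := exists_between ha
    have hleft : ∀ᶠ n in atTop, b < Function.leftLim x.toReal (r n) := by
      by_cases hbot : IsBot t
      · refine Eventually.of_forall fun n => hb.trans_le ?_
        rcases (hbot (r n)).eq_or_lt with hn | hn
        · rw [← hn, leftLim_eq_of_isBot hbot]
        · exact x.monotone_toReal.le_leftLim hn
      · obtain ⟨c, hc⟩ : ∃ c, c < t := by
          simpa only [IsBot, not_forall, not_le] using hbot
        obtain ⟨l, hl, hlt⟩ := exists_Ioc_subset_of_mem_nhds (ht.eventually_const_lt hb) ⟨c, hc⟩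
        have : (Ioo l t).Nonempty := by
          have h1 : (l : ℝ) < t := hl
          refine ⟨⟨(l + t) / 2, ?_, ?_⟩, ?_, ?_⟩
          · have := l.2.1; have := t.2.1; linarith
          · have := t.2.2; linarith
          · change (l : ℝ) < (l + t) / 2; linarith
          · change ((l : ℝ) + t) / 2 < t; linarith
        obtain ⟨d, hd⟩ := this
        filter_upwards [hrt.eventually (lt_mem_nhds hd.2)] with n hn
        have hbd : b < x.toReal d := hlt ⟨hd.1, hd.2.le⟩
        exact hbd.trans_le (x.monotone_toReal.le_leftLim hn)
    filter_upwards [hleft, hlim.eventually (gt_mem_nhds (sub_pos.2 hab))] with n h1 h2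
    have := hry n
    linarith
  · obtain ⟨b, hb, hab⟩ := exists_between ha
    filter_upwards [hx.eventually (gt_mem_nhds hb),
      hlim.eventually (gt_mem_nhds (sub_pos.2 hab))] with n h1 h2
    have := hyr n
    linarith

/-- The value at `T` is the maximum of the path, so it converges even if the limit jumps at `T`. -/
theorem tendsto_right_of_m1Dist (hT : 0 ≤ T) {x : DUp T} {y : ℕ → DUp T}
    (h : ∀ n : ℕ, m1Dist x.toReal (y n).toReal < ENNReal.ofReal (1 / ((n : ℝ) + 1))) :
    Tendsto (fun n => (y n).toReal ⟨T, right_mem_Icc.2 hT⟩) atTop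
      (𝓝 (x.toReal ⟨T, right_mem_Icc.2 hT⟩)) := by
  have hlim : Tendsto (fun n : ℕ => 1 / ((n : ℝ) + 1)) atTop (𝓝 0) :=
    tendsto_one_div_add_atTop_nhds_zero_nat
  rw [tendsto_iff_dist_tendsto_zero]
  refine squeeze_zero (fun _ => dist_nonneg) (fun n => ?_) hlim
  obtain ⟨h1, h2⟩ := exists_near_of_m1Dist_lt (h n)
  obtain ⟨r, -, hr, -⟩ := h1 ⟨T, right_mem_Icc.2 hT⟩
  obtain ⟨s, hs⟩ := h2 ⟨T, right_mem_Icc.2 hT⟩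
  have := x.monotone_toReal (show r ≤ ⟨T, right_mem_Icc.2 hT⟩ from r.2.2)
  have := (y n).monotone_toReal (show s ≤ ⟨T, right_mem_Icc.2 hT⟩ from s.2.2)
  rw [Real.dist_eq, abs_le]
  constructor <;> linarith

theorem continuousWithinAt_Ici (x : DUp T) (t : Icc (0 : ℝ) T) :
    ContinuousWithinAt x (Ici t) t := (x.2.1 t).1

theorem continuous_toReal_right (hT : 0 ≤ T) :
    Continuous fun x : DUp T => x.toReal ⟨T, right_mem_Icc.2 hT⟩ :=
  continuous_of_m1Dist fun _ _ h => tendsto_right_of_m1Dist hT h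

theorem continuous_right (hT : 0 ≤ T) :
    Continuous fun x : DUp T => x ⟨T, right_mem_Icc.2 hT⟩ :=
  NNReal.isEmbedding_coe.continuous_iff.2 (continuous_toReal_right hT)

/-- The path extended to `ℝ` by its boundary values. -/
noncomputable def extend (hT : 0 ≤ T) (x : DUp T) (u : ℝ) : ℝ≥0 := x (projIcc 0 T hT u)

theorem monotone_extend (hT : 0 ≤ T) (x : DUp T) : Monotone (x.extend hT) :=
  x.2.2.comp (monotone_projIcc hT)

theorem extend_le_right (hT : 0 ≤ T) (x : DUp T) (u : ℝ) :
    x.extend hT u ≤ x ⟨T, right_mem_Icc.2 hT⟩ := x.2.2 (projIcc 0 T hT u).2.2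

theorem continuousWithinAt_extend (hT : 0 ≤ T) (x : DUp T) (u : ℝ) :
    ContinuousWithinAt (x.extend hT) (Ici u) u :=
  (x.continuousWithinAt_Ici (projIcc 0 T hT u)).comp continuous_projIcc.continuousWithinAt
    fun _ hv => monotone_projIcc hT hv

theorem extend_coe (hT : 0 ≤ T) (x : DUp T) (t : Icc (0 : ℝ) T) : x.extend hT t = x t := by
  simp [extend]

/-- A monotone path has countably many discontinuities, and `k ≠ 0` makes their preimage countable.
The constant extensions add no exceptional set: the path is continuous at `0` by right-continuity,
and the values at `T` always converge. -/
theorem ae_tendsto_extend_of_m1Dist (hT : 0 ≤ T) {x : DUp T} {y : ℕ → DUp T}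
    (h : ∀ n : ℕ, m1Dist x.toReal (y n).toReal < ENNReal.ofReal (1 / ((n : ℝ) + 1)))
    (r : ℝ) {k : ℝ} (hk : k ≠ 0) :
    ∀ᵐ v : ℝ, Tendsto (fun n => (y n).extend hT (r + k * v)) atTop
      (𝓝 (x.extend hT (r + k * v))) := by
  have hS : {t | ¬ ContinuousAt x.toReal t}.Countable := x.monotone_toReal.countable_not_continuousAt
  have hinj : Function.Injective fun v : ℝ => r + k * v := fun a b hab => by
    simpa [hk] using hab
  have hc := (hS.image Subtype.val).preimage hinj
  filter_upwards [hc.ae_notMem volume] with v hv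
  rw [← NNReal.tendsto_coe]
  set u := r + k * v with hu
  by_cases hc : ContinuousAt x.toReal (projIcc 0 T hT u)
  · exact tendsto_of_m1Dist h hc
  rcases le_or_gt T u with hTu | hTu
  · have : projIcc 0 T hT u = ⟨T, right_mem_Icc.2 hT⟩ := projIcc_of_right_le hT hTu
    simp only [extend, this]
    exact tendsto_right_of_m1Dist hT h
  rcases le_or_gt u 0 with h0u | h0u
  · refine absurd ?_ hc
    rw [projIcc_of_le_left hT h0u]
    have h1 := x.continuousWithinAt_Ici ⟨0, left_mem_Icc.2 hT⟩
    have h2 : Ici (⟨0, left_mem_Icc.2 hT⟩ : Icc (0 : ℝ) T) = univ :=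
      eq_univ_of_forall fun s => s.2.1
    rw [h2, continuousWithinAt_univ] at h1
    exact NNReal.continuous_coe.continuousAt.comp h1
  · exact absurd ⟨projIcc 0 T hT u, hc, by rw [projIcc_of_mem hT ⟨h0u.le, hTu.le⟩]⟩ hv

/-! ### Time averages as M₁-continuous functionals -/

/-- The average of `ψ ∘ τ` over the times `[r, r + k]`. -/
noncomputable def average (hT : 0 ≤ T) (r k : ℝ) (ψ : C(ℝ≥0, ℝ)) (τ : DUp T) : ℝ :=
  ∫ v in Icc (0 : ℝ) 1, ψ (τ.extend hT (r + k * v))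

theorem measurable_extend (hT : 0 ≤ T) (x : DUp T) : Measurable (x.extend hT) :=
  (x.monotone_extend hT).measurable

theorem norm_comp_extend_le (hT : 0 ≤ T) (ψ : C(ℝ≥0, ℝ)) {a : ℝ≥0} {C : ℝ}
    (hC : ∀ s ≤ a, |ψ s| ≤ C) (τ : DUp T) (hτ : τ ⟨T, right_mem_Icc.2 hT⟩ ≤ a) (u : ℝ) :
    ‖ψ (τ.extend hT u)‖ ≤ C := hC _ ((τ.extend_le_right hT u).trans hτ)

theorem exists_bound (ψ : C(ℝ≥0, ℝ)) (a : ℝ≥0) : ∃ C, ∀ s ≤ a, |ψ s| ≤ C := by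
  obtain ⟨C, hC⟩ := (isCompact_Icc (a := (0 : ℝ≥0)) (b := a)).exists_bound_of_continuousOn
    ψ.continuous.continuousOn
  exact ⟨C, fun s hs => hC s ⟨zero_le, hs⟩⟩

theorem measurable_comp_extend (hT : 0 ≤ T) (ψ : C(ℝ≥0, ℝ)) (τ : DUp T) (r k : ℝ) :
    Measurable fun v : ℝ => ψ (τ.extend hT (r + k * v)) :=
  ψ.continuous.measurable.comp ((τ.measurable_extend hT).comp (by fun_prop))

theorem integrable_comp_extend (hT : 0 ≤ T) (ψ : C(ℝ≥0, ℝ)) (τ : DUp T) (r k : ℝ) :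
    Integrable (fun v : ℝ => ψ (τ.extend hT (r + k * v))) (volume.restrict (Icc 0 1)) := by
  obtain ⟨C, hC⟩ := exists_bound ψ (τ ⟨T, right_mem_Icc.2 hT⟩)
  exact Integrable.of_bound (measurable_comp_extend hT ψ τ r k).aestronglyMeasurable C
    (Eventually.of_forall fun v => norm_comp_extend_le hT ψ hC τ le_rfl _)

theorem continuous_average_right (hT : 0 ≤ T) (r : ℝ) {k : ℝ} (hk : k ≠ 0) (ψ : C(ℝ≥0, ℝ)) :
    Continuous (average hT r k ψ) := by
  refine continuous_of_m1Dist fun x y h => ?_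
  -- All distances are below `1`, so every `y n` stays below `x(T) + 1` and one constant dominates
  -- all integrands.
  obtain ⟨C, hC⟩ := exists_bound ψ (x ⟨T, right_mem_Icc.2 hT⟩ + 1)
  refine tendsto_integral_of_dominated_convergence (fun _ => C)
    (fun n => (measurable_comp_extend hT ψ (y n) r k).aestronglyMeasurable)
    (integrable_const _) (fun n => Eventually.of_forall fun v => ?_) ?_
  · refine norm_comp_extend_le hT ψ hC _ ?_ _
    obtain ⟨s, -, hs, -⟩ := (exists_near_of_m1Dist_lt (h n)).1 ⟨T, right_mem_Icc.2 hT⟩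
    have h1 : 1 / ((n : ℝ) + 1) ≤ 1 := by
      rw [div_le_one (by positivity)]; linarith [(Nat.cast_nonneg n : (0 : ℝ) ≤ n)]
    have := x.monotone_toReal (show s ≤ ⟨T, right_mem_Icc.2 hT⟩ from s.2.2)
    rw [← NNReal.coe_le_coe, NNReal.coe_add, NNReal.coe_one]
    change (y n).toReal _ ≤ x.toReal _ + 1
    linarith
  · filter_upwards [ae_restrict_of_ae (ae_tendsto_extend_of_m1Dist hT h r hk)] with v hv
    exact (ψ.continuous.tendsto _).comp hv

/-- Near `τ₀` the paths stay in the compact interval `[0, τ₀(T) + 1]`, where `ψ` converges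
uniformly; this reduces joint continuity to continuity in `τ` for fixed `ψ₀`. -/
theorem continuous_average (hT : 0 ≤ T) (r : ℝ) {k : ℝ} (hk : k ≠ 0) :
    Continuous fun p : C(ℝ≥0, ℝ) × DUp T => average hT r k p.1 p.2 := by
  rw [continuous_iff_continuousAt]
  rintro ⟨ψ₀, τ₀⟩
  have h1 : Tendsto (fun p : C(ℝ≥0, ℝ) × DUp T => average hT r k ψ₀ p.2) (𝓝 (ψ₀, τ₀))
      (𝓝 (average hT r k ψ₀ τ₀)) :=
    ((continuous_average_right hT r hk ψ₀).tendsto τ₀).comp continuous_snd.continuousAt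
  have h2 : Tendsto (fun p : C(ℝ≥0, ℝ) × DUp T => average hT r k p.1 p.2 - average hT r k ψ₀ p.2)
      (𝓝 (ψ₀, τ₀)) (𝓝 0) := by
    rw [Metric.tendsto_nhds]
    intro ε hε
    have hψ := ContinuousMap.tendsto_iff_forall_isCompact_tendstoUniformlyOn.1
      (continuous_fst.tendsto (ψ₀, τ₀)) (Icc 0 (τ₀ ⟨T, right_mem_Icc.2 hT⟩ + 1)) isCompact_Icc
    have hψ := Metric.tendstoUniformlyOn_iff.1 hψ (ε / 2) (half_pos hε)
    have hτ : ∀ᶠ p : C(ℝ≥0, ℝ) × DUp T in 𝓝 (ψ₀, τ₀),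
        p.2 ⟨T, right_mem_Icc.2 hT⟩ < τ₀ ⟨T, right_mem_Icc.2 hT⟩ + 1 :=
      (((continuous_right hT).comp continuous_snd).tendsto (ψ₀, τ₀)).eventually
        (gt_mem_nhds (lt_add_one (τ₀ ⟨T, right_mem_Icc.2 hT⟩)))
    filter_upwards [hψ, hτ] with p hp hpτ
    rw [dist_zero_right, average, average, ← integral_sub (integrable_comp_extend hT _ _ r k)
      (integrable_comp_extend hT _ _ r k)]
    refine lt_of_le_of_lt (norm_integral_le_of_norm_le_const (C := ε / 2)
      (Eventually.of_forall fun v => ?_)) ?_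
    · have := hp (p.2.extend hT (r + k * v))
        ⟨zero_le, (p.2.extend_le_right hT _).trans hpτ.le⟩
      rw [dist_comm, dist_eq_norm] at this
      exact this.le
    · simp; linarith
  simpa [ContinuousAt] using h1.add h2

theorem average_le {hT : 0 ≤ T} {ψ : C(ℝ≥0, ℝ)} {C : ℝ} (h : ∀ s, |ψ s| ≤ C) (r k : ℝ)
    (τ : DUp T) : |average hT r k ψ τ| ≤ C := by
  have h1 : ‖average hT r k ψ τ‖ ≤ C * (volume.restrict (Icc (0 : ℝ) 1)).real univ :=
    norm_integral_le_of_norm_le_const (Eventually.of_forall fun v => h _)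
  simpa using h1

/-- Averages over shrinking time windows to the right of `r` converge to the value at `r`. -/
theorem tendsto_average (hT : 0 ≤ T) (ψ : C(ℝ≥0, ℝ)) (τ : DUp T) (r : ℝ) {a k : ℕ → ℝ}
    (ha : Tendsto a atTop (𝓝 0)) (ha0 : ∀ n, 0 ≤ a n) (hk : Tendsto k atTop (𝓝 0))
    (hk0 : ∀ n, 0 ≤ k n) :
    Tendsto (fun n => average hT (r + a n) (k n) ψ τ) atTop (𝓝 (ψ (τ.extend hT r))) := by
  obtain ⟨C, hC⟩ := exists_bound ψ (τ ⟨T, right_mem_Icc.2 hT⟩)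
  have h0 : ψ (τ.extend hT r) = ∫ v in Icc (0 : ℝ) 1, ψ (τ.extend hT r) := by simp
  rw [h0]
  refine tendsto_integral_of_dominated_convergence (fun _ => C)
    (fun n => (measurable_comp_extend hT ψ τ _ _).aestronglyMeasurable)
    (integrable_const _) (fun n => Eventually.of_forall fun v =>
      norm_comp_extend_le hT ψ hC _ le_rfl _) ?_
  filter_upwards [ae_restrict_mem measurableSet_Icc] with v hv
  refine (ψ.continuous.tendsto _).comp ((τ.continuousWithinAt_extend hT r).tendsto.comp ?_)
  refine tendsto_nhdsWithin_iff.2 ⟨?_, Eventually.of_forall fun n => ?_⟩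
  · simpa using (tendsto_const_nhds (x := r)).add ha |>.add (hk.mul_const v)
  · have := ha0 n; have := mul_nonneg (hk0 n) hv.1
    rw [mem_Ici]; linarith

end DUp

/-! ### Running supremum and oscillation -/

theorem exists_unitInterval_mul_eq {b c : ℝ≥0} (h : b ≤ c) :
    ∃ u : unitInterval, u.1.toNNReal * c = b := by
  rcases eq_or_ne c 0 with rfl | hc
  · exact ⟨0, by simp [le_antisymm h zero_le]⟩
  · refine ⟨⟨(b / c : ℝ≥0), NNReal.coe_nonneg _, by exact_mod_cast div_le_one_of_le₀ h zero_le⟩, ?_⟩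
    rw [Real.toNNReal_coe, div_mul_cancel₀ b hc]

/-- The supremum of `|φ|` over `[0, a]`. -/
noncomputable def supNorm (φ : C(ℝ≥0, ℝ)) (a : ℝ≥0) : ℝ :=
  ‖φ.comp (⟨fun u => u.1.toNNReal * a, by fun_prop⟩ : C(unitInterval, ℝ≥0))‖

/-- Rescaling `[0, a]` to the fixed compact interval `[0, 1]` turns the moving endpoint into a
parameter, and currying gives continuity in the uniform norm. -/
theorem continuous_supNorm : Continuous fun p : C(ℝ≥0, ℝ) × ℝ≥0 => supNorm p.1 p.2 := by
  refine continuous_norm.comp (ContinuousMap.continuous_of_continuous_uncurry _ ?_)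
  change Continuous fun q : (C(ℝ≥0, ℝ) × ℝ≥0) × unitInterval => q.1.1 (q.2.1.toNNReal * q.1.2)
  fun_prop

theorem supNorm_le_iff {φ : C(ℝ≥0, ℝ)} {a : ℝ≥0} {C : ℝ} :
    supNorm φ a ≤ C ↔ ∀ s ≤ a, |φ s| ≤ C := by
  rw [supNorm, ContinuousMap.norm_le_of_nonempty]
  constructor
  · intro h s hs
    obtain ⟨u, rfl⟩ := exists_unitInterval_mul_eq hs
    exact h u
  · intro h u
    refine h _ (mul_le_of_le_one_left zero_le ?_)
    simpa using u.2.2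

theorem le_supNorm (φ : C(ℝ≥0, ℝ)) {a s : ℝ≥0} (h : s ≤ a) : |φ s| ≤ supNorm φ a :=
  supNorm_le_iff.1 le_rfl s h

theorem supNorm_mono (φ : C(ℝ≥0, ℝ)) {a b : ℝ≥0} (h : a ≤ b) : supNorm φ a ≤ supNorm φ b :=
  supNorm_le_iff.2 fun _ hs => le_supNorm φ (hs.trans h)

theorem iSup_enorm_eq_supNorm (φ : C(ℝ≥0, ℝ)) (a : ℝ≥0) :
    ⨆ s : Iic a, ‖φ (s : ℝ≥0)‖ₑ = ENNReal.ofReal (supNorm φ a) := by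
  refine le_antisymm (iSup_le fun s => ?_) ?_
  · rw [← ofReal_norm]
    exact ENNReal.ofReal_le_ofReal (le_supNorm φ s.2)
  · refine le_of_forall_ge fun c hc => ?_
    rcases eq_or_ne c ∞ with rfl | hc'
    · exact le_top
    rw [ENNReal.ofReal_le_iff_le_toReal hc', supNorm_le_iff]
    intro s hs
    rw [← ENNReal.ofReal_le_iff_le_toReal hc', ← Real.norm_eq_abs, ofReal_norm]
    exact (le_iSup (fun s : Iic a => ‖φ (s : ℝ≥0)‖ₑ) ⟨s, hs⟩).trans hc

/-- The oscillation of `φ` on `[0, a]` over distances at most `ε`. -/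
noncomputable def osc (φ : C(ℝ≥0, ℝ)) (a ε : ℝ≥0) : ℝ :=
  ‖(⟨fun u => φ (u.1.1.toNNReal * a) -
      φ (min a (u.1.1.toNNReal * a + u.2.1.toNNReal * ε)), by fun_prop⟩ :
      C(unitInterval × unitInterval, ℝ))‖

theorem continuous_osc : Continuous fun p : (C(ℝ≥0, ℝ) × ℝ≥0) × ℝ≥0 => osc p.1.1 p.1.2 p.2 := by
  refine continuous_norm.comp (ContinuousMap.continuous_of_continuous_uncurry _ ?_)
  change Continuous fun q : ((C(ℝ≥0, ℝ) × ℝ≥0) × ℝ≥0) × unitInterval × unitInterval =>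
    q.1.1.1 (q.2.1.1.toNNReal * q.1.1.2) -
      q.1.1.1 (min q.1.1.2 (q.2.1.1.toNNReal * q.1.1.2 + q.2.2.1.toNNReal * q.1.2))
  fun_prop

theorem osc_zero (φ : C(ℝ≥0, ℝ)) (a : ℝ≥0) : osc φ a 0 = 0 := by
  rw [osc, norm_eq_zero]
  ext u
  have : u.1.1.toNNReal * a ≤ a := mul_le_of_le_one_left zero_le (by simpa using u.1.2.2)
  simp [min_eq_right this]

theorem abs_sub_le_osc (φ : C(ℝ≥0, ℝ)) {a ε s t : ℝ≥0} (hst : s ≤ t) (hta : t ≤ a)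
    (hε : t ≤ s + ε) : |φ s - φ t| ≤ osc φ a ε := by
  obtain ⟨u, hu⟩ := exists_unitInterval_mul_eq (hst.trans hta)
  obtain ⟨v, hv⟩ := exists_unitInterval_mul_eq (show t - s ≤ ε from tsub_le_iff_left.2 hε)
  have h := ContinuousMap.norm_coe_le_norm (⟨fun u => φ (u.1.1.toNNReal * a) -
      φ (min a (u.1.1.toNNReal * a + u.2.1.toNNReal * ε)), by fun_prop⟩ :
      C(unitInterval × unitInterval, ℝ)) (u, v)
  simpa [osc, hu, hv, add_tsub_cancel_of_le hst, min_eq_right hta] using h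

/-- If the jumps of `τ` are at most `ε`, then the supremum of `|φ|` over `[0, τ(T)]` is controlled
by the supremum over the range of `τ` and the oscillation of `φ`. -/
theorem DUp.supNorm_le {T : ℝ} (hT : 0 ≤ T) (φ : C(ℝ≥0, ℝ)) (τ : DUp T) {ε : ℝ≥0}
    (h0 : τ ⟨0, left_mem_Icc.2 hT⟩ = 0) (hj : ∀ t, τ.jump t ≤ ε) {C : ℝ}
    (hC : ∀ t, |φ (τ t)| ≤ C) :
    supNorm φ (τ ⟨T, right_mem_Icc.2 hT⟩) ≤ C + osc φ (τ ⟨T, right_mem_Icc.2 hT⟩) ε := by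
  refine supNorm_le_iff.2 fun s hs => ?_
  -- The witness is the first time at which `τ` reaches `s`: right-continuity gives `s ≤ τ t`, while
  -- the left limit is at most `s` and the jump at most `ε`. At time `0` there is no earlier value
  -- to compare with, and `τ 0 = 0` is used instead.
  obtain ⟨t, hst, hts⟩ : ∃ t, s ≤ τ t ∧ τ t ≤ s + ε := by
    have : Fact ((0 : ℝ) ≤ T) := ⟨hT⟩
    set S : Set (Icc (0 : ℝ) T) := {t | s ≤ τ t} with hS
    have hne : S.Nonempty := ⟨⟨T, right_mem_Icc.2 hT⟩, hs⟩
    have hglb : IsGLB S (sInf S) := isGLB_sInf S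
    have hmem : s ≤ τ (sInf S) := by
      have h1 : (𝓝[S] (sInf S)).NeBot := hglb.nhdsWithin_neBot hne
      have h2 : Tendsto τ (𝓝[S] (sInf S)) (𝓝 (τ (sInf S))) :=
        (τ.continuousWithinAt_Ici (sInf S)).mono fun t ht => hglb.1 ht
      exact ge_of_tendsto h2 (eventually_mem_nhdsWithin)
    refine ⟨sInf S, hmem, ?_⟩
    by_cases hbot : sInf S = ⟨0, left_mem_Icc.2 hT⟩
    · rw [hbot, h0]; exact zero_le
    have hlt : (⟨0, left_mem_Icc.2 hT⟩ : Icc (0 : ℝ) T) < sInf S :=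
      lt_of_le_of_ne (sInf S).2.1 (Ne.symm hbot)
    have hleft : Function.leftLim τ.toReal (sInf S) ≤ s := by
      have hlim := τ.monotone_toReal.tendsto_leftLim (sInf S)
      have hnb : (𝓝[<] (sInf S)).NeBot := by
        refine nhdsLT_neBot_of_exists_lt ⟨_, hlt⟩
      refine le_of_tendsto hlim ?_
      filter_upwards [self_mem_nhdsWithin] with t ht
      have : ¬ s ≤ τ t := fun h => absurd (hglb.1 h) (not_le.2 ht)
      exact_mod_cast (not_le.1 this).le
    have h3 := hj (sInf S)
    rw [DUp.jump] at h3
    rw [← NNReal.coe_le_coe, NNReal.coe_add]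
    change τ.toReal _ ≤ _
    linarith
  have h1 := abs_sub_le_osc φ hst (τ.2.2 t.2.2 : τ t ≤ τ ⟨T, right_mem_Icc.2 hT⟩) hts
  have h2 := hC t
  have h3 := abs_sub_abs_le_abs_sub (φ s) (φ (τ t))
  linarith

theorem supNorm_lt_iff {φ : C(ℝ≥0, ℝ)} {a : ℝ≥0} {C : ℝ} :
    supNorm φ a < C ↔ ∀ s ≤ a, |φ s| < C := by
  refine ⟨fun h s hs => (le_supNorm φ hs).trans_lt h, fun h => ?_⟩
  rw [supNorm, ContinuousMap.norm_lt_iff_of_nonempty]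
  exact fun u => h _ (mul_le_of_le_one_left zero_le (by simpa using u.2.2))

/-- The truncation of `x` to `[-L, L]`. -/
noncomputable def truncate (L x : ℝ) : ℝ := max (-L) (min L x)

theorem continuous_truncate (L : ℝ) : Continuous (truncate L) := by
  unfold truncate; fun_prop

theorem abs_truncate_le {L : ℝ} (hL : 0 ≤ L) (x : ℝ) : |truncate L x| ≤ L :=
  abs_le.2 ⟨le_max_left _ _, max_le (by linarith) (min_le_left _ _)⟩

theorem abs_truncate_le_abs {L : ℝ} (hL : 0 ≤ L) (x : ℝ) : |truncate L x| ≤ |x| :=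
  abs_le.2 ⟨le_max_of_le_right (le_min (by linarith [abs_nonneg x]) (neg_abs_le x)),
    max_le (by linarith [abs_nonneg x]) ((min_le_right _ _).trans (le_abs_self x))⟩

theorem truncate_eq_self {L x : ℝ} (h : |x| ≤ L) : truncate L x = x := by
  rw [abs_le] at h
  rw [truncate, min_eq_right h.2, max_eq_right h.1]

/-! ### Optional sampling for continuous martingales -/

section OptionalSampling

variable {Ω : Type*} {m : MeasurableSpace Ω} {P : Measure Ω} {𝓕 : Filtration ℝ≥0 m}

theorem isStoppingTime_ceil {τ : Ω → ℝ≥0}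
    (hτ : IsStoppingTime 𝓕 (fun ω => (τ ω : WithTop ℝ≥0))) (k : ℕ) :
    IsStoppingTime 𝓕
      (fun ω => (((⌈((k : ℝ≥0) + 1) * τ ω⌉₊ : ℝ≥0) / (k + 1) : ℝ≥0) : WithTop ℝ≥0)) := by
  intro i
  have hk : (0 : ℝ≥0) < k + 1 := by positivity
  have key : {ω | (((⌈((k : ℝ≥0) + 1) * τ ω⌉₊ : ℝ≥0) / (k + 1) : ℝ≥0) : WithTop ℝ≥0) ≤ i} =
      {ω | (τ ω : WithTop ℝ≥0) ≤ ((⌊((k : ℝ≥0) + 1) * i⌋₊ : ℝ≥0) / (k + 1) : ℝ≥0)} := by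
    ext ω
    simp only [mem_ofPred_eq, WithTop.coe_le_coe]
    rw [div_le_iff₀ hk, le_div_iff₀ hk, mul_comm i, mul_comm (τ ω), ← Nat.le_floor_iff zero_le,
      Nat.ceil_le]
  rw [key]
  refine 𝓕.mono ?_ _ (hτ _)
  rw [div_le_iff₀ hk, mul_comm i]
  exact Nat.floor_le zero_le

theorem le_ceil_mul_div (k : ℕ) (x : ℝ≥0) :
    x ≤ (⌈((k : ℝ≥0) + 1) * x⌉₊ : ℝ≥0) / (k + 1) := by
  rw [le_div_iff₀ (by positivity), mul_comm]
  exact Nat.le_ceil _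

theorem ceil_mul_div_le (k : ℕ) (x : ℝ≥0) :
    (⌈((k : ℝ≥0) + 1) * x⌉₊ : ℝ≥0) / (k + 1) ≤ x + 1 / (k + 1) := by
  have hk : (0 : ℝ≥0) < k + 1 := by positivity
  rw [div_le_iff₀ hk, add_mul x, one_div, inv_mul_cancel₀ hk.ne', mul_comm x]
  exact (Nat.ceil_lt_add_one zero_le).le

theorem tendsto_ceil_mul_div (x : ℝ≥0) :
    Tendsto (fun k : ℕ => (⌈((k : ℝ≥0) + 1) * x⌉₊ : ℝ≥0) / (k + 1)) atTop (𝓝 x) := by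
  refine tendsto_of_tendsto_of_tendsto_of_le_of_le tendsto_const_nhds ?_
    (fun k => le_ceil_mul_div k x) (fun k => ceil_mul_div_le k x)
  have : Tendsto (fun k : ℕ => 1 / ((k : ℝ≥0) + 1)) atTop (𝓝 0) :=
    tendsto_one_div_add_atTop_nhds_zero_nat
  simpa using tendsto_const_nhds.add this

variable [IsProbabilityMeasure P] {X : ℝ≥0 → Ω → ℝ}

theorem measurable_comp_of_isStoppingTime (hX : StronglyAdapted 𝓕 X)
    (hc : ∀ ω, Continuous fun t => X t ω) {τ : Ω → ℝ≥0}
    (hτ : IsStoppingTime 𝓕 (fun ω => (τ ω : WithTop ℝ≥0))) :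
    Measurable[hτ.measurableSpace] (fun ω => X (τ ω) ω) := by
  exact measurable_stoppedValue (hX.isStronglyProgressive_of_continuous hc) hτ

/-- Optional sampling at a bounded stopping time for a martingale with continuous paths. -/
theorem integrable_and_ae_eq_condExp_of_le (hX : Martingale X 𝓕 P)
    (hc : ∀ ω, Continuous fun t => X t ω) {τ : Ω → ℝ≥0}
    (hτ : IsStoppingTime 𝓕 (fun ω => (τ ω : WithTop ℝ≥0))) {N : ℝ≥0} (hN : ∀ ω, τ ω ≤ N) :
    Integrable (fun ω => X (τ ω) ω) P ∧
      (fun ω => X (τ ω) ω) =ᵐ[P] P[X (N + 1) | hτ.measurableSpace] := by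
  -- Approximation of `τ` from above by grid-valued times, which exceed `τ` by at most `1`; hence
  -- the horizon `N + 1`. The sampled values are conditional expectations of one variable, so they
  -- are uniformly integrable and converge in `L¹`.
  have hs := fun k : ℕ => isStoppingTime_ceil hτ k
  have hle : ∀ (k : ℕ) ω, (((⌈((k : ℝ≥0) + 1) * τ ω⌉₊ : ℝ≥0) / (k + 1) : ℝ≥0) : WithTop ℝ≥0)
      ≤ ((N + 1 : ℝ≥0) : WithTop ℝ≥0) := fun k ω => by
    refine WithTop.coe_le_coe.2 ((ceil_mul_div_le k _).trans (add_le_add (hN ω) ?_))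
    exact div_le_one_of_le₀ (by simp) zero_le
  have hY : ∀ k : ℕ, (fun ω => X ((⌈((k : ℝ≥0) + 1) * τ ω⌉₊ : ℝ≥0) / (k + 1)) ω) =ᵐ[P]
      P[X (N + 1) | (hs k).measurableSpace] := fun k => by
    exact hX.stoppedValue_ae_eq_condExp_of_le_const_of_countable_range (hs k) (hle k)
      ((countable_range fun n : ℕ => (((n : ℝ≥0) / (k + 1) : ℝ≥0) : WithTop ℝ≥0)).mono
        (by rintro _ ⟨ω, rfl⟩; exact ⟨_, rfl⟩))
  have hUI := (hX.integrable (N + 1)).uniformIntegrable_condExp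
    (ℱ := fun k => (hs k).measurableSpace) (fun k => (hs k).measurableSpace_le)
  have hlim : ∀ᵐ ω ∂P, Tendsto (fun k => P[X (N + 1) | (hs k).measurableSpace] ω) atTop
      (𝓝 (X (τ ω) ω)) := by
    filter_upwards [ae_all_iff.2 hY] with ω hω
    simp_rw [← hω]
    exact ((hc ω).tendsto _).comp (tendsto_ceil_mul_div (τ ω))
  have hmem := hUI.memLp_of_ae_tendsto hlim
  have hint : Integrable (fun ω => X (τ ω) ω) P := memLp_one_iff_integrable.1 hmem
  refine ⟨hint, ae_eq_condExp_of_forall_setIntegral_eq hτ.measurableSpace_le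
    (hX.integrable _) (fun _ _ _ => hint.integrableOn) (fun s hsm _ => ?_)
    (measurable_comp_of_isStoppingTime hX.1 hc hτ).stronglyMeasurable.aestronglyMeasurable⟩
  have hL1 := tendsto_Lp_finite_of_tendsto_ae le_rfl ENNReal.one_ne_top hUI.1 hmem hUI.2.1 hlim
  have h1 := tendsto_setIntegral_of_L1' _ hint.aestronglyMeasurable
    (Eventually.of_forall fun k => integrable_condExp) hL1 s
  refine tendsto_nhds_unique h1 (tendsto_const_nhds.congr fun k => ?_)
  refine (setIntegral_condExp (hs k).measurableSpace_le (hX.integrable _) ?_).symm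
  exact hτ.measurableSpace_mono (hs k) (fun ω => WithTop.coe_le_coe.2 (le_ceil_mul_div k _)) s hsm

theorem integral_sub_mul_eq_zero (hX : Martingale X 𝓕 P)
    (hc : ∀ ω, Continuous fun t => X t ω) {a b : Ω → ℝ≥0}
    (ha : IsStoppingTime 𝓕 (fun ω => (a ω : WithTop ℝ≥0)))
    (hb : IsStoppingTime 𝓕 (fun ω => (b ω : WithTop ℝ≥0))) (hab : ∀ ω, a ω ≤ b ω) {N : ℝ≥0}
    (hN : ∀ ω, b ω ≤ N) {G : Ω → ℝ} (hG : Measurable[ha.measurableSpace] G)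
    (hG1 : ∀ ω, |G ω| ≤ 1) :
    ∫ ω, G ω * (X (b ω) ω - X (a ω) ω) ∂P = 0 := by
  obtain ⟨hia, hea⟩ := integrable_and_ae_eq_condExp_of_le hX hc ha fun ω => (hab ω).trans (hN ω)
  obtain ⟨hib, heb⟩ := integrable_and_ae_eq_condExp_of_le hX hc hb hN
  set Y : Ω → ℝ := fun ω => X (b ω) ω - X (a ω) ω with hY
  have hYi : Integrable Y P := hib.sub hia
  have hmono : ha.measurableSpace ≤ hb.measurableSpace :=
    ha.measurableSpace_mono hb fun ω => WithTop.coe_le_coe.2 (hab ω)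
  have hY0 : P[Y | ha.measurableSpace] =ᵐ[P] 0 := by
    have h1 : P[fun ω => X (b ω) ω | ha.measurableSpace] =ᵐ[P]
        P[X (N + 1) | ha.measurableSpace] :=
      (condExp_congr_ae heb).trans (condExp_condExp_of_le hmono hb.measurableSpace_le)
    have h2 : P[fun ω => X (a ω) ω | ha.measurableSpace] =ᵐ[P]
        P[X (N + 1) | ha.measurableSpace] :=
      (condExp_congr_ae hea).trans (condExp_condExp_of_le le_rfl ha.measurableSpace_le)
    filter_upwards [condExp_sub hib hia ha.measurableSpace, h1, h2] with ω h3 h4 h5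
    change P[(fun ω => X (b ω) ω) - fun ω => X (a ω) ω | ha.measurableSpace] ω = 0
    rw [h3, Pi.sub_apply, h4, h5, sub_self]
  have h := condExp_stronglyMeasurable_mul_of_bound ha.measurableSpace_le hG.stronglyMeasurable hYi
    1 (Eventually.of_forall hG1)
  have h' : P[G * Y | ha.measurableSpace] =ᵐ[P] 0 := by
    filter_upwards [h, hY0] with ω h1 h2
    rw [h1, Pi.mul_apply, h2]; simp
  calc ∫ ω, G ω * Y ω ∂P = ∫ ω, P[G * Y | ha.measurableSpace] ω ∂P :=
        (integral_condExp ha.measurableSpace_le).symm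
    _ = 0 := by rw [integral_congr_ae h']; simp

/-! ### Hitting times and truncated increments -/

variable {Z : Ω → C(ℝ≥0, ℝ)}

theorem measurable_supNorm (hZ : ∀ t, Measurable fun ω => Z ω t) (t : ℝ≥0)  :
    Measurable fun ω => supNorm (Z ω) t := by
  refine measurable_of_Iic fun C => ?_
  have : (fun ω => supNorm (Z ω) t) ⁻¹' Iic C =
      ⋂ n : ℕ, {ω | |Z ω ((TopologicalSpace.denseSeq unitInterval n).1.toNNReal * t)| ≤ C} := by
    ext ω
    simp only [mem_preimage, mem_Iic, mem_iInter, mem_ofPred_eq]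
    constructor
    · exact fun h n => supNorm_le_iff.1 h _ (mul_le_of_le_one_left zero_le
        (by simpa using (TopologicalSpace.denseSeq unitInterval n).2.2))
    · intro h
      rw [supNorm, ContinuousMap.norm_le_of_nonempty]
      exact fun u => (TopologicalSpace.denseRange_denseSeq unitInterval).induction_on
        (p := fun u : unitInterval => |Z ω (u.1.toNNReal * t)| ≤ C) u
        (isClosed_le (by fun_prop) continuous_const) h
  rw [this]
  exact MeasurableSet.iInter fun n => measurableSet_le (hZ _).norm measurable_const

/-- The first time at which `|φ|` reaches `L`, capped at `N`. -/
noncomputable def hitTime (L : ℝ) (N : ℝ≥0) (φ : C(ℝ≥0, ℝ)) : ℝ≥0 :=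
  sInf ({s | L ≤ |φ s|} ∪ {N})

theorem hitTime_mem (L : ℝ) (N : ℝ≥0) (φ : C(ℝ≥0, ℝ)) :
    hitTime L N φ ∈ {s | L ≤ |φ s|} ∪ {N} := by
  refine IsClosed.csInf_mem ?_ ⟨N, Or.inr rfl⟩ (OrderBot.bddBelow _)
  exact (isClosed_le continuous_const (by fun_prop)).union isClosed_singleton

theorem hitTime_le (L : ℝ) (N : ℝ≥0) (φ : C(ℝ≥0, ℝ)) : hitTime L N φ ≤ N :=
  csInf_le (OrderBot.bddBelow _) (Or.inr rfl)

theorem hitTime_le_of_le_abs {L : ℝ} {N : ℝ≥0} {φ : C(ℝ≥0, ℝ)} {s : ℝ≥0} (h : L ≤ |φ s|) :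
    hitTime L N φ ≤ s :=
  csInf_le (OrderBot.bddBelow _) (Or.inl h)

theorem hitTime_le_iff {L : ℝ} {N : ℝ≥0} {φ : C(ℝ≥0, ℝ)} {t : ℝ≥0} :
    hitTime L N φ ≤ t ↔ N ≤ t ∨ L ≤ supNorm φ t := by
  constructor
  · intro h
    rcases hitTime_mem L N φ with h1 | h1
    · exact Or.inr (le_trans h1 (le_supNorm φ h))
    · exact Or.inl (h1 ▸ h)
  · rintro (h | h)
    · exact (hitTime_le L N φ).trans h
    · by_contra! hlt
      refine absurd h (not_le.2 (supNorm_lt_iff.2 fun s hs => ?_))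
      by_contra! hL
      exact (hs.trans_lt hlt).not_ge (hitTime_le_of_le_abs hL)

theorem isStoppingTime_hitTime (hZ : StronglyAdapted 𝓕 fun t ω => Z ω t) (L : ℝ) (N : ℝ≥0) :
    IsStoppingTime 𝓕 (fun ω => (hitTime L N (Z ω) : WithTop ℝ≥0)) := by
  intro t
  simp only [WithTop.coe_le_coe, hitTime_le_iff]
  -- each supremum up to time `t` is measurable at time `t`
  have h : MeasurableSet[𝓕 t] {ω | L ≤ supNorm (Z ω) t} := by
    -- The path frozen at time `t` has all coordinates measurable at time `t` and the same supremum
    -- over `[0, t]`.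
    let W : Ω → C(ℝ≥0, ℝ) := fun ω => (Z ω).comp ⟨fun s => min s t, by fun_prop⟩
    have hW : ∀ s, Measurable[𝓕 t] fun ω => W ω s := fun s =>
      ((hZ (min s t)).mono (𝓕.mono (min_le_right _ _))).measurable
    have hEq : ∀ ω, supNorm (Z ω) t = supNorm (W ω) t := fun ω => by
      refine eq_of_forall_ge_iff fun C => ?_
      rw [supNorm_le_iff, supNorm_le_iff]
      refine forall₂_congr fun s hs => ?_
      simp [W, min_eq_left hs]
    simp_rw [hEq]
    exact @measurableSet_le _ _ _ _ _ (𝓕 t) _ _ _ _ _ measurable_const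
      (@measurable_supNorm _ (𝓕 t) _ hW t)
  exact (MeasurableSet.const _).union h

/-- A nonzero hitting time is approached from the left by times with `|φ| ≤ L`. It must be nonzero
because `|φ 0|` may already exceed `L`. -/
theorem abs_le_of_le_hitTime {L : ℝ} {N : ℝ≥0} {φ : C(ℝ≥0, ℝ)} (h0 : hitTime L N φ ≠ 0)
    {s : ℝ≥0} (hs : s ≤ hitTime L N φ) : |φ s| ≤ L := by
  have hlt : ∀ s < hitTime L N φ, |φ s| ≤ L := fun s hs => by
    by_contra! hL
    exact hs.not_ge (hitTime_le_of_le_abs hL.le)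
  rcases hs.eq_or_lt with rfl | hs
  · have hnb : (𝓝[<] (hitTime L N φ)).NeBot := nhdsLT_neBot_of_exists_lt ⟨0, pos_iff_ne_zero.2 h0⟩
    have ht : Tendsto (fun s => |φ s|) (𝓝[<] (hitTime L N φ)) (𝓝 |φ (hitTime L N φ)|) :=
      ((continuous_abs.comp φ.continuous).tendsto _).mono_left nhdsWithin_le_nhds
    exact le_of_tendsto ht (by filter_upwards [self_mem_nhdsWithin] with s hs using hlt s hs)
  · exact hlt s hs

theorem measurable_of_isStoppingTime {τ : Ω → ℝ≥0}
    (hτ : IsStoppingTime 𝓕 (fun ω => (τ ω : WithTop ℝ≥0))) : Measurable τ :=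
  (hτ.measurable.mono hτ.measurableSpace_le le_rfl).untopA

theorem measurable_supNorm_comp (hZ : ∀ t, Measurable fun ω => Z ω t) {β : Ω → ℝ≥0}
    (hβ : Measurable β) : Measurable fun ω => supNorm (Z ω) (β ω) := by
  have hc : ∀ ω, Continuous fun t : ℝ≥0 => supNorm (Z ω) t := fun ω =>
    Continuous.comp (g := fun p : C(ℝ≥0, ℝ) × ℝ≥0 => supNorm p.1 p.2)
      (f := fun t : ℝ≥0 => (Z ω, t)) continuous_supNorm (by fun_prop)
  have hu : Measurable (Function.uncurry fun (t : ℝ≥0) ω => supNorm (Z ω) t) :=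
    measurable_uncurry_of_continuous_of_measurable hc (measurable_supNorm hZ)
  exact Measurable.comp (f := fun ω => (β ω, ω)) hu (hβ.prodMk measurable_id')

/-- The increment `D` stopped on reaching `L` has mean zero against `G` and coincides with the
truncated increment `F` when the supremum up to `β` is below `L` and `β ≤ N`. Elsewhere `|F|` and
`|D|` are each at most `2 * L`, whence `4 * L`. -/
theorem abs_integral_truncate_sub_mul_le (hZ : Martingale (fun t ω => Z ω t) 𝓕 P)
    {α β : Ω → ℝ≥0} (hα : IsStoppingTime 𝓕 (fun ω => (α ω : WithTop ℝ≥0)))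
    (hβ : IsStoppingTime 𝓕 (fun ω => (β ω : WithTop ℝ≥0))) (hαβ : ∀ ω, α ω ≤ β ω)
    {G : Ω → ℝ} (hG : Measurable[hα.measurableSpace] G) (hG1 : ∀ ω, |G ω| ≤ 1)
    {L : ℝ} (hL : 0 ≤ L) :
    |∫ ω, G ω * (truncate L (Z ω (β ω)) - truncate L (Z ω (α ω))) ∂P| ≤
      4 * L * P.real {ω | L ≤ supNorm (Z ω) (β ω)} := by
  have hcont : ∀ ω, Continuous fun t => Z ω t := fun ω => (Z ω).continuous
  have hmeas : ∀ {τ : Ω → ℝ≥0}, IsStoppingTime 𝓕 (fun ω => (τ ω : WithTop ℝ≥0)) →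
      Measurable (fun ω => Z ω (τ ω)) := fun hτ =>
    (measurable_comp_of_isStoppingTime hZ.1 hcont hτ).mono hτ.measurableSpace_le le_rfl
  have hβm := measurable_of_isStoppingTime hβ
  have hbad : MeasurableSet {ω | L ≤ supNorm (Z ω) (β ω)} :=
    measurableSet_le measurable_const
      (measurable_supNorm_comp (fun s => ((hZ.1 s).mono (𝓕.le s)).measurable) hβm)
  have key : ∀ N : ℕ, |∫ ω, G ω * (truncate L (Z ω (β ω)) - truncate L (Z ω (α ω))) ∂P| ≤
      -- The cap `N` makes the stopping times bounded for optional sampling; its cost vanishes as `N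
      -- → ∞` because `β` is finite.
      4 * L * (P.real {ω | L ≤ supNorm (Z ω) (β ω)} + P.real {ω | (N : ℝ≥0) < β ω}) := by
    intro N
    have hρ := isStoppingTime_hitTime hZ.1 L N
    set ρ : Ω → ℝ≥0 := fun ω => hitTime L N (Z ω) with hρdef
    have hmin : ∀ {τ : Ω → ℝ≥0}, IsStoppingTime 𝓕 (fun ω => (τ ω : WithTop ℝ≥0)) →
        IsStoppingTime 𝓕 (fun ω => ((min (τ ω) (ρ ω) : ℝ≥0) : WithTop ℝ≥0)) := fun hτ => by
      simpa only [WithTop.coe_min] using hτ.min hρ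
    have ha := hmin hα
    have hb := hmin hβ
    have hset : ∀ s, MeasurableSet[hα.measurableSpace] s →
        MeasurableSet[ha.measurableSpace] (s ∩ {ω | α ω ≤ ρ ω}) := fun s hs => by
      have := hα.measurableSet_inter_le hρ s hs
      rw [IsStoppingTime.measurableSet] at this ⊢
      simpa only [WithTop.coe_min, WithTop.coe_le_coe] using this
    -- `G` need not be measurable at `min α ρ`, but its restriction to `{α ≤ ρ}` is; off this set
    -- the stopped increment vanishes.
    set G' : Ω → ℝ := {ω | α ω ≤ ρ ω}.indicator G with hG'
    have hG'm : Measurable[ha.measurableSpace] G' := by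
      intro s hs
      classical
      rw [hG', indicator_preimage, Set.ite]
      have h1 := hset univ MeasurableSet.univ
      rw [univ_inter] at h1
      exact (hset _ (hG hs)).union ((measurable_const hs).diff h1)
    have hzero := integral_sub_mul_eq_zero hZ hcont ha hb
      (fun ω => min_le_min_right _ (hαβ ω)) (N := N)
      (fun ω => (min_le_right _ _).trans (hitTime_le _ _ _)) hG'm (fun ω => by
        rw [hG', indicator_apply]; split_ifs
        · exact hG1 ω
        · simp)
    set D : Ω → ℝ := fun ω => Z ω (min (β ω) (ρ ω)) - Z ω (min (α ω) (ρ ω)) with hD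
    have hDm : Measurable D := (hmeas hb).sub (hmeas ha)
    have hDle : ∀ ω, |D ω| ≤ 2 * L := fun ω => by
      -- If `ρ = 0`, both stopped values equal `Z 0`, so `D = 0` however large `|Z 0|` is.
      by_cases h0 : ρ ω = 0
      · simpa [hD, h0] using hL
      · have h1 := abs_le_of_le_hitTime h0 (min_le_right (β ω) (ρ ω))
        have h2 := abs_le_of_le_hitTime h0 (min_le_right (α ω) (ρ ω))
        have := abs_sub (Z ω (min (β ω) (ρ ω))) (Z ω (min (α ω) (ρ ω)))
        simp only [hD]; linarith
    have hGD : ∀ ω, G' ω * D ω = G ω * D ω := fun ω => by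
      by_cases h : α ω ≤ ρ ω
      · rw [hG', indicator_of_mem (show ω ∈ {ω | α ω ≤ ρ ω} from h)]
      · have h1 : ρ ω ≤ α ω := (not_le.1 h).le
        simp [hD, min_eq_right h1, min_eq_right (h1.trans (hαβ ω))]
    replace hzero : ∫ ω, G ω * D ω ∂P = 0 := (integral_congr_ae
      (Eventually.of_forall fun ω => (hGD ω).symm)).trans hzero
    have hGm : Measurable G := hG.mono hα.measurableSpace_le le_rfl
    set F : Ω → ℝ := fun ω => truncate L (Z ω (β ω)) - truncate L (Z ω (α ω)) with hF
    have hFm : Measurable F := ((continuous_truncate L).measurable.comp (hmeas hβ)).sub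
      ((continuous_truncate L).measurable.comp (hmeas hα))
    have hFle : ∀ ω, |F ω| ≤ 2 * L := fun ω => by
      have h1 := abs_truncate_le hL (Z ω (β ω))
      have h2 := abs_truncate_le hL (Z ω (α ω))
      have := abs_sub (truncate L (Z ω (β ω))) (truncate L (Z ω (α ω)))
      simp only [hF]; linarith
    have hint : ∀ {H : Ω → ℝ}, Measurable H → (∀ ω, |H ω| ≤ 2 * L) →
        Integrable (fun ω => G ω * H ω) P := fun hH hHle =>
      Integrable.of_bound (hGm.mul hH).aestronglyMeasurable (2 * L) (Eventually.of_forall fun ω => by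
        rw [Real.norm_eq_abs, abs_mul]
        calc _ ≤ 1 * (2 * L) := mul_le_mul (hG1 ω) (hHle ω) (abs_nonneg _) zero_le_one
          _ = 2 * L := one_mul _)
    have hsub : ∫ ω, G ω * F ω ∂P = ∫ ω, (G ω * F ω - G ω * D ω) ∂P := by
      rw [integral_sub (hint hFm hFle) (hint hDm hDle), hzero, sub_zero]
    rw [hsub]
    set B : Set Ω := {ω | L ≤ supNorm (Z ω) (β ω)} ∪ {ω | (N : ℝ≥0) < β ω} with hB
    have hBm : MeasurableSet B := hbad.union (measurableSet_lt measurable_const hβm)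
    calc |∫ ω, (G ω * F ω - G ω * D ω) ∂P| ≤ ∫ ω, B.indicator (fun _ => 4 * L) ω ∂P := by
          rw [← Real.norm_eq_abs]
          refine norm_integral_le_of_norm_le ((integrable_const (4 * L)).indicator hBm)
            (Eventually.of_forall fun ω => ?_)
          rw [← mul_sub, Real.norm_eq_abs, abs_mul]
          by_cases hω : ω ∈ B
          · rw [indicator_of_mem hω]
            have := abs_sub (F ω) (D ω)
            have := hFle ω
            have := hDle ω
            calc _ ≤ 1 * (4 * L) :=
                  mul_le_mul (hG1 ω) (by linarith) (abs_nonneg _) zero_le_one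
              _ = 4 * L := one_mul _
          · rw [indicator_of_notMem hω]
            simp only [hB, mem_union, mem_ofPred_eq, not_or, not_le, not_lt] at hω
            have hβρ : β ω ≤ ρ ω := by
              rcases hitTime_mem L N (Z ω) with h | h
              · by_contra! hlt
                exact absurd (supNorm_lt_iff.1 hω.1 _ hlt.le) (not_lt.2 h)
              · exact hω.2.trans_eq h.symm
            have h1 := (supNorm_lt_iff.1 hω.1 _ le_rfl).le
            have h2 := (supNorm_lt_iff.1 hω.1 _ (hαβ ω)).le
            simp [hF, hD, min_eq_left hβρ, min_eq_left ((hαβ ω).trans hβρ),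
              truncate_eq_self h1, truncate_eq_self h2]
      _ = 4 * L * P.real B := by
          rw [integral_indicator hBm, setIntegral_const, smul_eq_mul, mul_comm]
      _ ≤ _ := mul_le_mul_of_nonneg_left (measureReal_union_le _ _) (by positivity)
  have hlim : Tendsto (fun N : ℕ => P.real {ω | (N : ℝ≥0) < β ω}) atTop (𝓝 0) := by
    have h := tendsto_measure_iInter_atTop (μ := P) (s := fun N : ℕ => {ω | (N : ℝ≥0) < β ω})
      (fun N => (measurableSet_lt measurable_const hβm).nullMeasurableSet)
      (fun i j hij ω (hω : (j : ℝ≥0) < β ω) =>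
        show (i : ℝ≥0) < β ω from lt_of_le_of_lt (by exact_mod_cast hij) hω) ⟨0, measure_ne_top _ _⟩
    have he : ⋂ N : ℕ, {ω | (N : ℝ≥0) < β ω} = ∅ := by
      refine eq_empty_of_forall_notMem fun ω hω => ?_
      obtain ⟨N, hN⟩ := exists_nat_ge (β ω)
      exact not_lt.2 hN (mem_iInter.1 hω N)
    rw [he, measure_empty] at h
    exact (ENNReal.tendsto_toReal ENNReal.zero_ne_top).comp h
  have := (hlim.const_add (P.real {ω | L ≤ supNorm (Z ω) (β ω)})).const_mul (4 * L)
  rw [add_zero] at this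
  exact ge_of_tendsto' this key

end OptionalSampling

/-! ### A martingale criterion for the natural filtration -/

theorem isPiSystem_preimage_isClosed {Ω : Type*} (f : Ω → ℝ) :
    IsPiSystem (preimage f '' {C | IsClosed C}) := by
  rintro _ ⟨C, hC, rfl⟩ _ ⟨D, hD, rfl⟩ -
  exact ⟨C ∩ D, IsClosed.inter hC hD, rfl⟩

section OwnFiltration

variable {ι Ω : Type*} [Preorder ι] [MeasurableSpace Ω] {P : Measure Ω}

theorem natural_eq_generateFrom {M : ι → Ω → ℝ} (hM : ∀ t, StronglyMeasurable (M t)) (s : ι) :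
    Filtration.natural M hM s = MeasurableSpace.generateFrom
      (piiUnionInter (fun i => preimage (M i) '' {C | IsClosed C}) (Iic s)) := by
  have hcomap : ∀ i, MeasurableSpace.comap (M i) (borel ℝ) =
      MeasurableSpace.generateFrom (preimage (M i) '' {C | IsClosed C}) := fun i => by
    rw [borel_eq_generateFrom_isClosed, MeasurableSpace.comap_generateFrom]
  change ⨆ j ≤ s, MeasurableSpace.comap (M j) (borel ℝ) = _
  refine le_antisymm (iSup₂_le fun j hj => ?_) (MeasurableSpace.generateFrom_le ?_)
  · rw [hcomap]
    exact MeasurableSpace.generateFrom_mono (subset_piiUnionInter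
      (π := fun i => preimage (M i) '' {C | IsClosed C}) (S := Iic s) hj)
  · rintro _ ⟨I, hI, f, hf, rfl⟩
    refine Finset.measurableSet_biInter _ fun i hi => ?_
    refine le_iSup₂ (f := fun j (_ : j ≤ s) => MeasurableSpace.comap (M j) (borel ℝ)) i (hI hi) _ ?_
    rw [hcomap]
    exact MeasurableSpace.measurableSet_generateFrom (hf i hi)

/-- If the increments of `M` are orthogonal to all products of bounded continuous functions of
the past, then `M` is a martingale with respect to its own filtration. -/
theorem isMartingaleOwnFiltration_of_forall_integral_prod_mul_eq_zero [IsProbabilityMeasure P]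
    {M : ι → Ω → ℝ} (hM : ∀ t, StronglyMeasurable (M t)) (hint : ∀ t, Integrable (M t) P)
    (h : ∀ s t, s ≤ t → ∀ I : Finset ι, (∀ i ∈ I, i ≤ s) → ∀ g : ι → C(ℝ, ℝ),
      (∀ i x, |g i x| ≤ 1) → ∫ ω, (∏ i ∈ I, g i (M i ω)) * (M t ω - M s ω) ∂P = 0) :
    IsMartingaleOwnFiltration M P := by
  refine ⟨hM, Filtration.stronglyAdapted_natural hM, fun s t hst => ?_⟩
  set D : Ω → ℝ := fun ω => M t ω - M s ω with hD
  have hDi : Integrable D P := (hint t).sub (hint s)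
  have huniv : ∫ ω, D ω ∂P = 0 := by
    simpa using h s t hst ∅ (by simp) (fun _ => 0) (by simp)
  have hle := (Filtration.natural M hM).le s
  have key : ∀ B, MeasurableSet[Filtration.natural M hM s] B → ∫ ω in B, D ω ∂P = 0 := by
    refine MeasurableSpace.induction_on_inter (C := fun B _ => ∫ ω in B, D ω ∂P = 0)
      (natural_eq_generateFrom hM s)
      (isPiSystem_piiUnionInter _ (fun i => isPiSystem_preimage_isClosed (M i)) _) ?_ ?_ ?_ ?_
    · simp
    · rintro _ ⟨I, hI, f, hf, rfl⟩
      have hf' : ∀ i ∈ I, ∃ C, IsClosed C ∧ M i ⁻¹' C = f i := hf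
      choose! C hC hCf using hf'
      have hδ : ∀ k : ℕ, (0 : ℝ) < 1 / ((k : ℝ) + 1) := fun k => by positivity
      -- Continuous functions decreasing to the indicators of the closed sets `C i`, so the
      -- hypothesis passes to the generating π-system.
      let g : ℕ → ι → C(ℝ, ℝ) := fun k i =>
        ⟨fun x => (thickenedIndicator (hδ k) (C i) x : ℝ), by fun_prop⟩
      have hg0 : ∀ k i x, 0 ≤ g k i x := fun k i x => NNReal.coe_nonneg _
      have hg1 : ∀ k i x, g k i x ≤ 1 := fun k i x =>
        (NNReal.coe_le_coe.2 (thickenedIndicator_le_one (hδ k) (C i) x)).trans_eq NNReal.coe_one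
      have hgabs : ∀ k i x, |g k i x| ≤ 1 := fun k i x => by
        rw [abs_of_nonneg (hg0 k i x)]; exact hg1 k i x
      have hglim : ∀ i ∈ I, ∀ x, Tendsto (fun k => g k i x) atTop
          (𝓝 ((C i).indicator (fun _ => (1 : ℝ)) x)) := fun i hi x => by
        have h1 := thickenedIndicator_tendsto_indicator_closure hδ
          tendsto_one_div_add_atTop_nhds_zero_nat (C i)
        have h2 := NNReal.tendsto_coe.2 ((tendsto_pi_nhds.1 h1) x)
        rw [(hC i hi).closure_eq] at h2
        have h3 : (C i).indicator (fun _ => (1 : ℝ)) x =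
            ((C i).indicator (fun _ => (1 : ℝ≥0)) x : ℝ≥0) := by
          by_cases hx : x ∈ C i <;> simp [hx]
        rw [h3]
        exact h2
      have hB : MeasurableSet (⋂ i ∈ I, f i) := Finset.measurableSet_biInter _ fun i hi => by
        rw [← hCf i hi]; exact (hM i).measurable (hC i hi).measurableSet
      have hlim : Tendsto (fun k => ∫ ω, (∏ i ∈ I, g k i (M i ω)) * D ω ∂P) atTop
          (𝓝 (∫ ω, (⋂ i ∈ I, f i).indicator D ω ∂P)) := by
        refine tendsto_integral_of_dominated_convergence (fun ω => |D ω|) (fun k => ?_)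
          hDi.abs (fun k => Eventually.of_forall fun ω => ?_) (Eventually.of_forall fun ω => ?_)
        · refine AEStronglyMeasurable.mul ?_ hDi.aestronglyMeasurable
          exact (Finset.measurable_prod _ fun i _ =>
            (g k i).continuous.measurable.comp (hM i).measurable).aestronglyMeasurable
        · rw [Real.norm_eq_abs, abs_mul, Finset.abs_prod]
          exact mul_le_of_le_one_left (abs_nonneg _)
            (Finset.prod_le_one (fun _ _ => abs_nonneg _) fun i _ => hgabs k i _)
        · have h1 := (tendsto_finsetProd I fun i hi => hglim i hi (M i ω)).mul_const (D ω)
          convert h1 using 2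
          by_cases hω : ω ∈ ⋂ i ∈ I, f i
          · rw [indicator_of_mem hω, Finset.prod_eq_one, one_mul]
            intro i hi
            refine indicator_of_mem ?_ _
            have := mem_iInter₂.1 hω i hi
            rwa [← hCf i hi] at this
          · rw [indicator_of_notMem hω]
            rw [mem_iInter₂] at hω
            push Not at hω
            obtain ⟨i, hi, hiω⟩ := hω
            rw [Finset.prod_eq_zero hi, zero_mul]
            refine indicator_of_notMem ?_ _
            rwa [← hCf i hi] at hiω
      rw [← integral_indicator hB]
      refine tendsto_nhds_unique hlim (tendsto_const_nhds.congr fun k => ?_)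
      exact (h s t hst I (fun i hi => hI hi) (g k) (hgabs k)).symm
    · intro B hB hB0
      have := integral_add_compl (hle B hB) hDi
      rw [hB0, huniv, zero_add] at this
      exact this
    · intro B hdisj hB hB0
      rw [integral_iUnion (fun i => hle _ (hB i)) hdisj hDi.integrableOn]
      simp [hB0]
  refine (ae_eq_condExp_of_forall_setIntegral_eq hle (hint t) (fun _ _ _ => (hint s).integrableOn)
    (fun B hB _ => ?_) (Filtration.stronglyAdapted_natural hM s).aestronglyMeasurable).symm
  have := key B hB
  rw [hD, integral_sub (hint t).integrableOn (hint s).integrableOn] at this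
  linarith

end OwnFiltration

/-! ### Smoothed increments before the limit -/

section Averages

variable {T : ℝ} {Ω : Type*}

theorem measurable_uncurry_of_continuousWithinAt_Ici [MeasurableSpace Ω] {f : ℝ → Ω → ℝ}
    (hf : ∀ v, Measurable (f v)) (hc : ∀ ω v, ContinuousWithinAt (fun v => f v ω) (Ici v) v) :
    Measurable (Function.uncurry f) := by
  have hk : ∀ k : ℕ, (0 : ℝ) < k + 1 := fun k => by positivity
  refine measurable_of_tendsto_metrizable
    (f := fun (k : ℕ) (p : ℝ × Ω) => f (⌈((k : ℝ) + 1) * p.1⌉ / (k + 1)) p.2) (fun k => ?_) ?_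
  · have h1 : Measurable fun q : ℤ × Ω => f ((q.1 : ℝ) / (k + 1)) q.2 :=
      measurable_from_prod_countable_right fun z => hf ((z : ℝ) / (k + 1))
    have h2 : Measurable fun p : ℝ × Ω => (⌈((k : ℝ) + 1) * p.1⌉, p.2) :=
      (Int.measurable_ceil.comp (by fun_prop)).prodMk measurable_snd
    exact Measurable.comp h1 h2
  · refine tendsto_pi_nhds.2 fun p => (hc p.2 p.1).tendsto.comp (tendsto_nhdsWithin_iff.2
      ⟨?_, Eventually.of_forall fun k => ?_⟩)
    · have h1 : Tendsto (fun k : ℕ => p.1 + 1 / ((k : ℝ) + 1)) atTop (𝓝 p.1) := by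
        simpa using (tendsto_const_nhds (x := p.1)).add
          (tendsto_one_div_add_atTop_nhds_zero_nat (𝕜 := ℝ))
      refine tendsto_of_tendsto_of_tendsto_of_le_of_le tendsto_const_nhds h1
        (fun k => ?_) (fun k => ?_)
      · rw [le_div_iff₀ (hk k), mul_comm]; exact Int.le_ceil _
      · have := (Int.ceil_lt_add_one (((k : ℝ) + 1) * p.1)).le
        have hk' := (hk k).ne'
        rw [div_le_iff₀ (hk k)]
        field_simp
        linarith
    · rw [mem_Ici, le_div_iff₀ (hk k), mul_comm]; exact Int.le_ceil _

/-- Capping `p.1` at `1` keeps every evaluation time at most `r + k ≤ u`, so joint measurability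
needs only the information available up to `u`. -/
theorem measurable_uncurry_comp_extend [MeasurableSpace Ω] (hT : 0 ≤ T) {Y : Ω → C(ℝ≥0, ℝ)}
    {A : Ω → DUp T} {r k u : ℝ} (hk : 0 ≤ k) (hu : r + k ≤ u)
    (h : ∀ s ≤ u, Measurable fun ω => Y ω ((A ω).extend hT s)) :
    Measurable fun p : ℝ × Ω => Y p.2 ((A p.2).extend hT (r + k * min p.1 1)) := by
  refine measurable_uncurry_of_continuousWithinAt_Ici
    (f := fun v ω => Y ω ((A ω).extend hT (r + k * min v 1))) (fun v => h _ ?_) fun ω v => ?_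
  · have := mul_le_of_le_one_right hk (min_le_right v 1)
    linarith
  · refine (Y ω).continuous.continuousAt.comp_continuousWithinAt ?_
    refine ((A ω).continuousWithinAt_extend hT _).comp (f := fun v : ℝ => r + k * min v 1)
      (Continuous.continuousWithinAt (by fun_prop)) fun w hw => ?_
    have := mul_le_mul_of_nonneg_left (min_le_min_right 1 (show v ≤ w from hw)) hk
    rw [mem_Ici]; linarith

theorem average_eq_min (hT : 0 ≤ T) (r k : ℝ) (ψ : C(ℝ≥0, ℝ)) (τ : DUp T) :
    DUp.average hT r k ψ τ = ∫ v in Icc (0 : ℝ) 1, ψ (τ.extend hT (r + k * min v 1)) :=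
  setIntegral_congr_fun measurableSet_Icc fun v hv => by simp only [min_eq_left hv.2]

theorem measurable_average [MeasurableSpace Ω] (hT : 0 ≤ T) {Y : Ω → C(ℝ≥0, ℝ)}
    {A : Ω → DUp T} {r k u : ℝ} (hk : 0 ≤ k) (hu : r + k ≤ u)
    (h : ∀ s ≤ u, Measurable fun ω => Y ω ((A ω).extend hT s)) :
    Measurable fun ω => DUp.average hT r k (Y ω) (A ω) := by
  simp_rw [average_eq_min]
  exact (measurable_uncurry_comp_extend hT hk hu h).stronglyMeasurable.integral_prod_left.measurable

/-- The truncation as a continuous map. -/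
noncomputable def truncateMap (L : ℝ) : C(ℝ, ℝ) := ⟨truncate L, continuous_truncate L⟩

/-- The increment of the truncated process from `s` to `t`, smoothed over time windows of length
`k` and weighted by functions of the past. -/
noncomputable def smoothedIncrement (hT : 0 ≤ T) (L : ℝ) (s t : ℝ) (I : Finset (Icc (0 : ℝ) T))
    (g : Icc (0 : ℝ) T → C(ℝ, ℝ)) (k : ℝ) (p : DCirc T) : ℝ :=
  (∏ i ∈ I, DUp.average hT i k ((g i).comp p.1) p.2) *
    (DUp.average hT (t + k) k ((truncateMap L).comp p.1) p.2 -
      DUp.average hT (s + k) k ((truncateMap L).comp p.1) p.2)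

theorem continuous_smoothedIncrement (hT : 0 ≤ T) (L s t : ℝ) (I : Finset (Icc (0 : ℝ) T))
    (g : Icc (0 : ℝ) T → C(ℝ, ℝ)) {k : ℝ} (hk : k ≠ 0) :
    Continuous (smoothedIncrement hT L s t I g k) := by
  have h : ∀ (r : ℝ) (f : C(ℝ, ℝ)), Continuous fun p : C(ℝ≥0, ℝ) × DUp T =>
      DUp.average hT r k (f.comp p.1) p.2 := fun r f =>
    (DUp.continuous_average hT r hk).comp
      (((ContinuousMap.continuous_postcomp f).comp continuous_fst).prodMk continuous_snd)
  exact (continuous_finsetProd I fun i _ => h _ _).mul ((h _ _).sub (h _ _))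

theorem abs_prod_average_le (hT : 0 ≤ T) (I : Finset (Icc (0 : ℝ) T))
    {g : Icc (0 : ℝ) T → C(ℝ, ℝ)} (hg : ∀ i x, |g i x| ≤ 1) (k : ℝ) (φ : C(ℝ≥0, ℝ)) (τ : DUp T) :
    |∏ i ∈ I, DUp.average hT i k ((g i).comp φ) τ| ≤ 1 := by
  rw [Finset.abs_prod]
  exact Finset.prod_le_one (fun _ _ => abs_nonneg _) fun i _ =>
    DUp.average_le (fun s => hg i (φ s)) _ _ _

theorem abs_smoothedIncrement_le (hT : 0 ≤ T) {L : ℝ} (hL : 0 ≤ L) (s t : ℝ)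
    (I : Finset (Icc (0 : ℝ) T)) {g : Icc (0 : ℝ) T → C(ℝ, ℝ)} (hg : ∀ i x, |g i x| ≤ 1) (k : ℝ)
    (p : DCirc T) : |smoothedIncrement hT L s t I g k p| ≤ 2 * L := by
  have h : ∀ r, |DUp.average hT r k ((truncateMap L).comp p.1) p.2| ≤ L := fun r =>
    DUp.average_le (fun s => abs_truncate_le hL _) _ _ _
  rw [smoothedIncrement, abs_mul]
  have h1 := h (t + k)
  have h2 := h (s + k)
  have h3 := abs_sub (DUp.average hT (t + k) k ((truncateMap L).comp p.1) p.2)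
    (DUp.average hT (s + k) k ((truncateMap L).comp p.1) p.2)
  calc _ ≤ 1 * (2 * L) := mul_le_mul (abs_prod_average_le hT I hg k p.1 p.2) (by linarith)
        (abs_nonneg _) zero_le_one
    _ = 2 * L := one_mul _

/-- By Fubini it suffices to bound the increment from `A (s+k+kv)` to `A (t+k+kv)` for each `v`. The
shift by `k` matters: the windows `[i, i+k]` of the past weights end by `s + k`, so the weight is
measurable at the earlier stopping time. -/
theorem abs_integral_smoothedIncrement_le {m : MeasurableSpace Ω} {P : Measure Ω}
    [IsProbabilityMeasure P] {𝓕 : Filtration ℝ≥0 m} (hT : 0 ≤ T) {Z : Ω → C(ℝ≥0, ℝ)}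
    {A : Ω → DUp T} (hZ : Martingale (fun t ω => Z ω t) 𝓕 P)
    (hA : ∀ t, IsStoppingTime 𝓕 (fun ω => ((A ω t : ℝ≥0) : WithTop ℝ≥0)))
    {L : ℝ} (hL : 0 ≤ L) {s t : ℝ} (hst : s ≤ t) (I : Finset (Icc (0 : ℝ) T))
    (hI : ∀ i ∈ I, (i : ℝ) ≤ s) {g : Icc (0 : ℝ) T → C(ℝ, ℝ)} (hg : ∀ i x, |g i x| ≤ 1) {k : ℝ}
    (hk : 0 ≤ k) :
    |∫ ω, smoothedIncrement hT L s t I g k (DCirc.mk (Z ω) (A ω)) ∂P| ≤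
      4 * L * P.real {ω | L ≤ supNorm (Z ω) (A ω ⟨T, right_mem_Icc.2 hT⟩)} := by
  have hcont : ∀ ω, Continuous fun t => Z ω t := fun ω => (Z ω).continuous
  have hst' : ∀ u, IsStoppingTime 𝓕 (fun ω => ((A ω).extend hT u : WithTop ℝ≥0)) := fun u => hA _
  have hm : ∀ {u w : ℝ}, w ≤ u → Measurable[(hst' u).measurableSpace]
      fun ω => Z ω ((A ω).extend hT w) := fun {u w} huw =>
    (measurable_comp_of_isStoppingTime hZ.1 hcont (hst' w)).mono
      ((hst' w).measurableSpace_mono (hst' u) fun ω =>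
        WithTop.coe_le_coe.2 ((A ω).monotone_extend hT huw)) le_rfl
  set G : Ω → ℝ := fun ω => ∏ i ∈ I, DUp.average hT i k ((g i).comp (Z ω)) (A ω) with hGdef
  have hG1 : ∀ ω, |G ω| ≤ 1 := fun ω => abs_prod_average_le hT I hg k (Z ω) (A ω)
  have hG : ∀ u, s + k ≤ u → Measurable[(hst' u).measurableSpace] G := fun u hu =>
    @Finset.measurable_prod _ _ _ _ _ _ (hst' u).measurableSpace _ _ fun i hi =>
      @measurable_average T Ω (hst' u).measurableSpace hT (fun ω => (g i).comp (Z ω)) A i k u hk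
        (by linarith [hI i hi]) fun w hw => (g i).continuous.measurable.comp (hm hw)
  have hGm : Measurable G := (hG _ le_rfl).mono (hst' _).measurableSpace_le le_rfl
  set f : ℝ → ℝ → Ω → ℝ := fun r v ω => truncate L (Z ω ((A ω).extend hT (r + k + k * min v 1)))
    with hf
  have hfm : ∀ r, Measurable fun p : ℝ × Ω => f r p.1 p.2 := fun r =>
    measurable_uncurry_comp_extend (Y := fun ω => (truncateMap L).comp (Z ω)) hT hk
      (le_refl (r + k + k)) fun w _ => (continuous_truncate L).measurable.comp
        ((hm le_rfl).mono (hst' w).measurableSpace_le le_rfl)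
  have hfL : ∀ r v ω, |f r v ω| ≤ L := fun r v ω => abs_truncate_le hL _
  set F : Ω → ℝ → ℝ := fun ω v => G ω * (f t v ω - f s v ω) with hF
  have hFL : ∀ ω v, |F ω v| ≤ 2 * L := fun ω v => by
    have h1 := hfL t v ω
    have h2 := hfL s v ω
    have h3 := abs_sub (f t v ω) (f s v ω)
    rw [hF, abs_mul]
    calc _ ≤ 1 * (2 * L) := mul_le_mul (hG1 ω) (by linarith) (abs_nonneg _) zero_le_one
      _ = 2 * L := one_mul _
  have hFm : Measurable (Function.uncurry F) :=
    (hGm.comp measurable_fst).mul (((hfm t).comp measurable_swap).sub ((hfm s).comp measurable_swap))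
  have hfi : ∀ r ω, Integrable (fun v => f r v ω) (volume.restrict (Icc 0 1)) := fun r ω =>
    Integrable.of_bound ((hfm r).comp measurable_prodMk_right).aestronglyMeasurable L
      (Eventually.of_forall fun v => hfL r v ω)
  have heq : ∀ ω, smoothedIncrement hT L s t I g k (DCirc.mk (Z ω) (A ω)) =
      ∫ v in Icc (0 : ℝ) 1, F ω v := fun ω => by
    rw [hF, integral_const_mul, integral_sub (hfi t ω) (hfi s ω)]
    change G ω * (DUp.average hT (t + k) k ((truncateMap L).comp (Z ω)) (A ω) -
      DUp.average hT (s + k) k ((truncateMap L).comp (Z ω)) (A ω)) = _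
    rw [average_eq_min, average_eq_min]
    rfl
  simp_rw [heq]
  rw [integral_integral_swap (Integrable.of_bound hFm.aestronglyMeasurable (2 * L)
    (Eventually.of_forall fun p => hFL p.1 p.2))]
  have hbound : ∀ v ∈ Icc (0 : ℝ) 1, ‖∫ ω, F ω v ∂P‖ ≤
      4 * L * P.real {ω | L ≤ supNorm (Z ω) (A ω ⟨T, right_mem_Icc.2 hT⟩)} := fun v hv => by
    have hkv : 0 ≤ k * min v 1 := mul_nonneg hk (le_min hv.1 zero_le_one)
    refine (abs_integral_truncate_sub_mul_le hZ (hst' (s + k + k * min v 1))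
      (hst' (t + k + k * min v 1)) (fun ω => (A ω).monotone_extend hT (by linarith))
      (hG _ (by linarith)) hG1 hL).trans ?_
    refine mul_le_mul_of_nonneg_left (measureReal_mono fun ω hω => ?_) (by positivity)
    exact le_trans hω (supNorm_mono _ ((A ω).extend_le_right hT _))
  have := norm_setIntegral_le_of_norm_le_const (μ := volume) (s := Icc (0 : ℝ) 1)
    (by simp) hbound
  simpa using this

end Averages

/-! ### Passage to the limit -/

section Limit

theorem tendsto_integral_of_tendstoInDistribution {E : Type*} [TopologicalSpace E]
    [MeasurableSpace E] [BorelSpace E] {Ω : ℕ → Type*} {mΩ : ∀ n, MeasurableSpace (Ω n)}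
    {P : ∀ n, Measure (Ω n)} [∀ n, IsProbabilityMeasure (P n)] {Ω' : Type*} [MeasurableSpace Ω']
    {P' : Measure Ω'} [IsProbabilityMeasure P'] {X : ∀ n, Ω n → E} {Y : Ω' → E}
    (h : TendstoInDistribution X atTop Y P P') {f : E → ℝ} (hf : Continuous f) {C : ℝ}
    (hC : ∀ x, |f x| ≤ C) :
    Tendsto (fun n => ∫ ω, f (X n ω) ∂P n) atTop (𝓝 (∫ ω, f (Y ω) ∂P')) := by
  have h1 : Tendsto (fun n => ∫ x, f x ∂(P n).map (X n)) atTop (𝓝 (∫ x, f x ∂P'.map Y)) :=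
    ProbabilityMeasure.tendsto_iff_forall_integral_tendsto.1 h.tendsto
      (BoundedContinuousFunction.ofNormedAddCommGroup f hf C hC)
  rw [integral_map h.aemeasurable_limit hf.measurable.aestronglyMeasurable] at h1
  exact h1.congr fun n =>
    integral_map (h.forall_aemeasurable n) hf.measurable.aestronglyMeasurable

variable {T : ℝ}

/-- The supremum of `|φ|` over `[0, τ(T)]`. -/
noncomputable def pathSup (hT : 0 ≤ T) (p : DCirc T) : ℝ :=
  supNorm p.1 (p.2 ⟨T, right_mem_Icc.2 hT⟩)

theorem continuous_pathSup (hT : 0 ≤ T) : Continuous (pathSup hT) := by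
  have h : Continuous fun p : C(ℝ≥0, ℝ) × DUp T => (p.1, p.2 ⟨T, right_mem_Icc.2 hT⟩) :=
    continuous_fst.prodMk ((DUp.continuous_right hT).comp continuous_snd)
  have h' : Continuous fun p : C(ℝ≥0, ℝ) × DUp T => supNorm p.1 (p.2 ⟨T, right_mem_Icc.2 hT⟩) :=
    Continuous.comp (g := fun q : C(ℝ≥0, ℝ) × ℝ≥0 => supNorm q.1 q.2)
      (f := fun p : C(ℝ≥0, ℝ) × DUp T => (p.1, p.2 ⟨T, right_mem_Icc.2 hT⟩)) continuous_supNorm h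
  exact h'

theorem pathSup_nonneg (hT : 0 ≤ T) (p : DCirc T) : 0 ≤ pathSup hT p := norm_nonneg _

/-- A bounded continuous minorant of `pathSup`, which is dominated by the supremum over the range
of the time change if its jumps are at most `ε`. -/
noncomputable def reducedSup (hT : 0 ≤ T) (K : ℝ) (ε : ℝ≥0) (p : DCirc T) : ℝ :=
  max 0 (min K (pathSup hT p - osc p.1 (p.2 ⟨T, right_mem_Icc.2 hT⟩) ε))

theorem continuous_reducedSup (hT : 0 ≤ T) (K : ℝ) (ε : ℝ≥0) :
    Continuous (reducedSup hT K ε) := by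
  have h : Continuous fun p : C(ℝ≥0, ℝ) × DUp T => ((p.1, p.2 ⟨T, right_mem_Icc.2 hT⟩), ε) :=
    (continuous_fst.prodMk ((DUp.continuous_right hT).comp continuous_snd)).prodMk continuous_const
  have h' : Continuous fun p : C(ℝ≥0, ℝ) × DUp T => osc p.1 (p.2 ⟨T, right_mem_Icc.2 hT⟩) ε :=
    Continuous.comp (g := fun q : (C(ℝ≥0, ℝ) × ℝ≥0) × ℝ≥0 => osc q.1.1 q.1.2 q.2)
      (f := fun p : C(ℝ≥0, ℝ) × DUp T => ((p.1, p.2 ⟨T, right_mem_Icc.2 hT⟩), ε)) continuous_osc h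
  have h'' : Continuous fun p : DCirc T => osc p.1 (p.2 ⟨T, right_mem_Icc.2 hT⟩) ε := h'
  exact continuous_const.max (continuous_const.min ((continuous_pathSup hT).sub h''))

theorem reducedSup_nonneg (hT : 0 ≤ T) (K : ℝ) (ε : ℝ≥0) (p : DCirc T) :
    0 ≤ reducedSup hT K ε p := le_max_left _ _

theorem reducedSup_le (hT : 0 ≤ T) {K : ℝ} (hK : 0 ≤ K) (ε : ℝ≥0) (p : DCirc T) :
    reducedSup hT K ε p ≤ K := max_le hK (min_le_left _ _)

theorem abs_reducedSup_le (hT : 0 ≤ T) {K : ℝ} (hK : 0 ≤ K) (ε : ℝ≥0) (p : DCirc T) :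
    |reducedSup hT K ε p| ≤ K := by
  rw [abs_of_nonneg (reducedSup_nonneg hT _ ε p)]
  exact reducedSup_le hT hK ε p

theorem ofReal_integral_reducedSup {Ω : Type*} {m : MeasurableSpace Ω} {P : Measure Ω}
    [IsProbabilityMeasure P] (hT : 0 ≤ T) {K : ℝ} (hK : 0 ≤ K) (ε : ℝ≥0) {W : Ω → DCirc T}
    (hW : AEMeasurable W P) : ENNReal.ofReal (∫ ω, reducedSup hT K ε (W ω) ∂P) =
      ∫⁻ ω, ENNReal.ofReal (reducedSup hT K ε (W ω)) ∂P :=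
  ofReal_integral_eq_lintegral_ofReal
    (Integrable.of_bound ((continuous_reducedSup hT K ε).measurable.comp_aemeasurable
      hW).aestronglyMeasurable K (Eventually.of_forall fun _ => abs_reducedSup_le hT hK ε _))
    (Eventually.of_forall fun _ => reducedSup_nonneg hT K ε _)

theorem tendsto_reducedSup (hT : 0 ≤ T) (p : DCirc T) :
    Tendsto (fun k : ℕ => reducedSup hT k (1 / ((k : ℝ≥0) + 1)) p) atTop (𝓝 (pathSup hT p)) := by
  set a := p.2 ⟨T, right_mem_Icc.2 hT⟩
  have h1 : Tendsto (fun k : ℕ => osc p.1 a (1 / ((k : ℝ≥0) + 1))) atTop (𝓝 0) := by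
    have h2 : Continuous fun ε : ℝ≥0 => osc p.1 a ε :=
      Continuous.comp (g := fun q : (C(ℝ≥0, ℝ) × ℝ≥0) × ℝ≥0 => osc q.1.1 q.1.2 q.2)
        (f := fun ε : ℝ≥0 => ((p.1, a), ε)) continuous_osc (by fun_prop)
    have h3 := (h2.tendsto 0).comp (tendsto_one_div_add_atTop_nhds_zero_nat (𝕜 := ℝ≥0))
    rwa [osc_zero] at h3
  have h2 : Tendsto (fun k : ℕ => max 0 (pathSup hT p - osc p.1 a (1 / ((k : ℝ≥0) + 1)))) atTop
      (𝓝 (pathSup hT p)) := by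
    have := (h1.const_sub (pathSup hT p)).max (tendsto_const_nhds (x := (0 : ℝ)))
    rw [sub_zero, max_eq_left (pathSup_nonneg hT p)] at this
    simpa only [max_comm] using this
  refine h2.congr' ?_
  filter_upwards [tendsto_natCast_atTop_atTop.eventually_ge_atTop (pathSup hT p)] with k hk
  rw [reducedSup, min_eq_right]
  exact (sub_le_self _ (norm_nonneg _)).trans hk

/-- Where all jumps are at most `ε`, subtracting the oscillation leaves at most the supremum over
the range; elsewhere the cap `K` bounds the functional. -/
theorem lintegral_reducedSup_le {Ω : Type*} {m : MeasurableSpace Ω} {P : Measure Ω} (hT : 0 ≤ T)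
    {Z : Ω → C(ℝ≥0, ℝ)} {A : Ω → DUp T} (hzero : ∀ᵐ ω ∂P, A ω ⟨0, left_mem_Icc.2 hT⟩ = 0)
    {K : ℝ} (hK : 0 ≤ K) (ε : ℝ≥0) :
    ∫⁻ ω, ENNReal.ofReal (reducedSup hT K ε (DCirc.mk (Z ω) (A ω))) ∂P ≤
      ∫⁻ ω, ⨆ t : Icc (0 : ℝ) T, ‖Z ω (A ω t)‖ₑ ∂P +
        ENNReal.ofReal K * P {ω | ∃ t, (ε : ℝ) < (A ω).jump t} := by
  -- A measurable hull of the same measure, since the event is an uncountable union.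
  set B := toMeasurable P {ω | ∃ t, (ε : ℝ) < (A ω).jump t} with hB
  have hBm : MeasurableSet B := measurableSet_toMeasurable _ _
  calc _ ≤ ∫⁻ ω, ((⨆ t : Icc (0 : ℝ) T, ‖Z ω (A ω t)‖ₑ) +
        B.indicator (fun _ => ENNReal.ofReal K) ω) ∂P := by
        refine lintegral_mono_ae ?_
        filter_upwards [hzero] with ω h0
        by_cases hω : ω ∈ B
        · rw [indicator_of_mem hω]
          exact le_add_left (ENNReal.ofReal_le_ofReal (reducedSup_le hT hK _ _))
        · refine le_add_right ?_
          have hj : ∀ t, (A ω).jump t ≤ ε := fun t => not_lt.1 fun h =>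
            hω (subset_toMeasurable _ _ ⟨t, h⟩)
          rcases eq_or_ne (⨆ t : Icc (0 : ℝ) T, ‖Z ω (A ω t)‖ₑ) ∞ with htop | htop
          · rw [htop]; exact le_top
          refine ENNReal.ofReal_le_of_le_toReal ?_
          have hle := DUp.supNorm_le hT (Z ω) (A ω) h0 hj
            (C := (⨆ t : Icc (0 : ℝ) T, ‖Z ω (A ω t)‖ₑ).toReal) fun t => by
              rw [← ENNReal.ofReal_le_iff_le_toReal htop, ← Real.norm_eq_abs, ofReal_norm]
              exact le_iSup (fun t : Icc (0 : ℝ) T => ‖Z ω (A ω t)‖ₑ) t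
          refine max_le ENNReal.toReal_nonneg ((min_le_right _ _).trans ?_)
          exact sub_le_iff_le_add.2 hle
    _ = _ := by
        rw [lintegral_add_right _ (measurable_const.indicator hBm), lintegral_indicator_const hBm,
          hB, measure_toMeasurable]

/-- A continuous function which vanishes below `L - 1` and is `1` above `L`. -/
noncomputable def ramp (L x : ℝ) : ℝ := max 0 (min 1 (x - L + 1))

theorem continuous_ramp (L : ℝ) : Continuous (ramp L) := by unfold ramp; fun_prop

theorem ramp_nonneg (L x : ℝ) : 0 ≤ ramp L x := le_max_left _ _

theorem ramp_le_one (L x : ℝ) : ramp L x ≤ 1 := max_le zero_le_one (min_le_left _ _)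

theorem ramp_eq_one {L x : ℝ} (h : L ≤ x) : ramp L x = 1 := by
  rw [ramp, min_eq_left (by linarith), max_eq_right zero_le_one]

theorem ramp_eq_zero {L x : ℝ} (h : x ≤ L - 1) : ramp L x = 0 := by
  rw [ramp, max_eq_left ((min_le_right _ _).trans (by linarith))]

theorem mul_ramp_le {L x : ℝ} (hL : 0 ≤ L) (hx : 0 ≤ x) : L * ramp L x ≤ x + 1 := by
  rcases le_total x (L - 1) with h | h
  · rw [ramp_eq_zero h]; linarith
  · exact (mul_le_of_le_one_right hL (ramp_le_one L x)).trans (by linarith)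

variable {Ω : ℕ → Type*} {mΩ : ∀ n, MeasurableSpace (Ω n)} {P : ∀ n, Measure (Ω n)}
  [∀ n, IsProbabilityMeasure (P n)] {𝓕 : ∀ n, Filtration ℝ≥0 (mΩ n)}
  {Zn : ∀ n, Ω n → C(ℝ≥0, ℝ)} {An : ∀ n, Ω n → DUp T}
  {Ω' : Type*} [MeasurableSpace Ω'] {P' : Measure Ω'} [IsProbabilityMeasure P']
  {Z : Ω' → C(ℝ≥0, ℝ)} {A : Ω' → DUp T}

/-- For fixed `K` and `ε`, weak convergence applies to the bounded continuous `reducedSup`, and the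
jump term `K P(jump > ε)` vanishes. Fatou's lemma along `K = k`, `ε = 1/(k+1)` then recovers the
full supremum. -/
theorem lintegral_pathSup_le (hT : 0 ≤ T) (hZA : Measurable fun ω => DCirc.mk (Z ω) (A ω))
    (hzero : ∀ n, ∀ᵐ ω ∂(P n), An n ω ⟨0, left_mem_Icc.2 hT⟩ = 0)
    (hjump : ∀ ε : ℝ, 0 < ε →
      Tendsto (fun n => P n {ω | ∃ t, ε < (An n ω).jump t}) atTop (𝓝 0))
    (hconv : TendstoInDistribution (fun n ω => DCirc.mk (Zn n ω) (An n ω)) atTop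
      (fun ω => DCirc.mk (Z ω) (A ω)) P P') :
    ∫⁻ ω, ENNReal.ofReal (pathSup hT (DCirc.mk (Z ω) (A ω))) ∂P' ≤
      ⨆ n, ∫⁻ ω, ⨆ t : Icc (0 : ℝ) T, ‖Zn n ω (An n ω t)‖ₑ ∂(P n) := by
  set C := ⨆ n, ∫⁻ ω, ⨆ t : Icc (0 : ℝ) T, ‖Zn n ω (An n ω t)‖ₑ ∂(P n) with hC
  have key : ∀ {K : ℝ} (_ : 0 ≤ K) {ε : ℝ≥0} (_ : 0 < ε),
      ∫⁻ ω, ENNReal.ofReal (reducedSup hT K ε (DCirc.mk (Z ω) (A ω))) ∂P' ≤ C := by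
    intro K hK ε hε
    have hcont := continuous_reducedSup hT K ε
    have h1 := (ENNReal.continuous_ofReal.tendsto _).comp
      (tendsto_integral_of_tendstoInDistribution hconv hcont (abs_reducedSup_le hT hK ε))
    have hlim : Tendsto (fun n => C + ENNReal.ofReal K *
        P n {ω | ∃ t, (ε : ℝ) < (An n ω).jump t}) atTop (𝓝 C) := by
      have := (ENNReal.Tendsto.const_mul (hjump ε hε)
        (Or.inr ENNReal.ofReal_ne_top : (0 : ℝ≥0∞) ≠ 0 ∨ ENNReal.ofReal K ≠ ∞)).const_add C
      simpa using this
    rw [← ofReal_integral_reducedSup hT hK ε hZA.aemeasurable]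
    refine le_of_tendsto_of_tendsto' h1 hlim fun n => ?_
    rw [Function.comp_apply,
      ofReal_integral_reducedSup hT hK ε (hconv.forall_aemeasurable n)]
    exact (lintegral_reducedSup_le hT (hzero n) hK ε).trans (add_le_add_left
      (le_iSup (fun n => ∫⁻ ω, ⨆ t : Icc (0 : ℝ) T, ‖Zn n ω (An n ω t)‖ₑ ∂(P n)) n) _)
  have hmeas : ∀ k : ℕ, Measurable fun ω =>
      ENNReal.ofReal (reducedSup hT k (1 / ((k : ℝ≥0) + 1)) (DCirc.mk (Z ω) (A ω))) := fun k =>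
    ((continuous_reducedSup hT _ _).measurable.comp hZA).ennreal_ofReal
  calc _ = ∫⁻ ω, liminf (fun k : ℕ => ENNReal.ofReal
        (reducedSup hT k (1 / ((k : ℝ≥0) + 1)) (DCirc.mk (Z ω) (A ω)))) atTop ∂P' :=
        lintegral_congr fun ω => (((ENNReal.continuous_ofReal.tendsto _).comp
          (tendsto_reducedSup hT (DCirc.mk (Z ω) (A ω)))).liminf_eq).symm
    _ ≤ _ := lintegral_liminf_le hmeas
    _ ≤ C := liminf_le_of_le (by isBoundedDefault) fun b hb => by
        obtain ⟨k, hk⟩ := hb.exists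
        exact hk.trans (key (Nat.cast_nonneg k) (by positivity))

/-- The indicator of `{S ≥ L}` is not continuous; replacing it by the larger `ramp L` lets both
sides of the prelimit bound converge. -/
theorem abs_integral_smoothedIncrement_limit_le (hT : 0 ≤ T)
    (hmart : ∀ n, Martingale (fun t ω => Zn n ω t) (𝓕 n) (P n))
    (hAst : ∀ n t, IsStoppingTime (𝓕 n) (fun ω => ((An n ω t : ℝ≥0) : WithTop ℝ≥0)))
    (hconv : TendstoInDistribution (fun n ω => DCirc.mk (Zn n ω) (An n ω)) atTop
      (fun ω => DCirc.mk (Z ω) (A ω)) P P')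
    {L : ℝ} (hL : 0 ≤ L) {s t : ℝ} (hst : s ≤ t) (I : Finset (Icc (0 : ℝ) T))
    (hI : ∀ i ∈ I, (i : ℝ) ≤ s) {g : Icc (0 : ℝ) T → C(ℝ, ℝ)} (hg : ∀ i x, |g i x| ≤ 1) {k : ℝ}
    (hk : 0 < k) :
    |∫ ω, smoothedIncrement hT L s t I g k (DCirc.mk (Z ω) (A ω)) ∂P'| ≤
      4 * L * ∫ ω, ramp L (pathSup hT (DCirc.mk (Z ω) (A ω))) ∂P' := by
  have hrc : Continuous fun p : DCirc T => ramp L (pathSup hT p) :=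
    (continuous_ramp L).comp (continuous_pathSup hT)
  have hr1 : ∀ p : DCirc T, |ramp L (pathSup hT p)| ≤ 1 := fun p => by
    rw [abs_of_nonneg (ramp_nonneg _ _)]; exact ramp_le_one _ _
  have h1 := tendsto_integral_of_tendstoInDistribution hconv
    (continuous_smoothedIncrement hT L s t I g hk.ne') (abs_smoothedIncrement_le hT hL s t I hg k)
  have h2 := tendsto_integral_of_tendstoInDistribution hconv hrc hr1
  refine le_of_tendsto_of_tendsto' h1.abs (h2.const_mul (4 * L)) fun n => ?_
  refine (abs_integral_smoothedIncrement_le hT (hmart n) (hAst n) hL hst I hI hg hk.le).trans ?_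
  refine mul_le_mul_of_nonneg_left ?_ (by positivity)
  have hint : Integrable (fun ω => ramp L (pathSup hT (DCirc.mk (Zn n ω) (An n ω)))) (P n) :=
    Integrable.of_bound
      (hrc.measurable.comp_aemeasurable (hconv.forall_aemeasurable n)).aestronglyMeasurable 1
      (Eventually.of_forall fun ω => hr1 _)
  have h3 := mul_meas_ge_le_integral_of_nonneg
    (Eventually.of_forall fun ω => ramp_nonneg L _) hint 1
  rw [one_mul] at h3
  refine le_trans (measureReal_mono fun ω hω => ?_) h3
  exact (ramp_eq_one hω).ge

theorem tendsto_smoothedIncrement (hT : 0 ≤ T) (L : ℝ) (s t : ℝ) (I : Finset (Icc (0 : ℝ) T))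
    (g : Icc (0 : ℝ) T → C(ℝ, ℝ)) (p : DCirc T) :
    Tendsto (fun k : ℕ => smoothedIncrement hT L s t I g (1 / ((k : ℝ) + 1)) p) atTop
      (𝓝 ((∏ i ∈ I, g i (p.1 (p.2 i))) * (truncate L (p.1 (p.2.extend hT t)) -
        truncate L (p.1 (p.2.extend hT s))))) := by
  have hlim : Tendsto (fun k : ℕ => 1 / ((k : ℝ) + 1)) atTop (𝓝 0) :=
    tendsto_one_div_add_atTop_nhds_zero_nat
  have hpos : ∀ k : ℕ, 0 ≤ 1 / ((k : ℝ) + 1) := fun k => by positivity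
  refine (tendsto_finsetProd I fun i _ => ?_).mul (Tendsto.sub ?_ ?_)
  · have := DUp.tendsto_average hT ((g i).comp p.1) p.2 i (a := fun _ => 0) tendsto_const_nhds
      (fun _ => le_rfl) hlim hpos
    simpa [DUp.extend_coe] using this
  · exact DUp.tendsto_average hT ((truncateMap L).comp p.1) p.2 t hlim hpos hlim hpos
  · exact DUp.tendsto_average hT ((truncateMap L).comp p.1) p.2 s hlim hpos hlim hpos

/-- Evaluation at `t` is not a continuous functional, but it is a pointwise limit of the continuous
averages over `[t, t + 1/(k+1)]`. -/
theorem measurable_comp_apply (hT : 0 ≤ T) (hZA : Measurable fun ω => DCirc.mk (Z ω) (A ω))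
    (t : Icc (0 : ℝ) T) : Measurable fun ω => Z ω (A ω t) := by
  have hlim : Tendsto (fun k : ℕ => 1 / ((k : ℝ) + 1)) atTop (𝓝 0) :=
    tendsto_one_div_add_atTop_nhds_zero_nat
  refine measurable_of_tendsto_metrizable
    (f := fun (k : ℕ) ω => DUp.average hT (t + 0) (1 / ((k : ℝ) + 1)) (Z ω) (A ω)) (fun k => ?_)
    (tendsto_pi_nhds.2 fun ω => ?_)
  · have hc : Continuous fun p : DCirc T => DUp.average hT (t + 0) (1 / ((k : ℝ) + 1)) p.1 p.2 :=
      DUp.continuous_average hT (t + 0) (by positivity)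
    exact hc.measurable.comp hZA
  · have := DUp.tendsto_average hT (Z ω) (A ω) t (a := fun _ => 0) tendsto_const_nhds
      (fun _ => le_rfl) hlim fun k => by positivity
    rwa [DUp.extend_coe] at this

theorem abs_integral_prod_mul_truncate_sub_le (hT : 0 ≤ T)
    (hZA : Measurable fun ω => DCirc.mk (Z ω) (A ω))
    (hmart : ∀ n, Martingale (fun t ω => Zn n ω t) (𝓕 n) (P n))
    (hAst : ∀ n t, IsStoppingTime (𝓕 n) (fun ω => ((An n ω t : ℝ≥0) : WithTop ℝ≥0)))
    (hconv : TendstoInDistribution (fun n ω => DCirc.mk (Zn n ω) (An n ω)) atTop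
      (fun ω => DCirc.mk (Z ω) (A ω)) P P')
    {L : ℝ} (hL : 0 ≤ L) {s t : Icc (0 : ℝ) T} (hst : s ≤ t) (I : Finset (Icc (0 : ℝ) T))
    (hI : ∀ i ∈ I, i ≤ s) {g : Icc (0 : ℝ) T → C(ℝ, ℝ)} (hg : ∀ i x, |g i x| ≤ 1) :
    |∫ ω, (∏ i ∈ I, g i (Z ω (A ω i))) *
        (truncate L (Z ω (A ω t)) - truncate L (Z ω (A ω s))) ∂P'| ≤
      4 * L * ∫ ω, ramp L (pathSup hT (DCirc.mk (Z ω) (A ω))) ∂P' := by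
  have hpos : ∀ k : ℕ, 0 < 1 / ((k : ℝ) + 1) := fun k => by positivity
  have h : Tendsto (fun k : ℕ => ∫ ω, smoothedIncrement hT L s t I g (1 / ((k : ℝ) + 1))
      (DCirc.mk (Z ω) (A ω)) ∂P') atTop (𝓝 (∫ ω, (∏ i ∈ I, g i (Z ω (A ω i))) *
        (truncate L (Z ω (A ω t)) - truncate L (Z ω (A ω s))) ∂P')) := by
    refine tendsto_integral_of_dominated_convergence (fun _ => 2 * L)
      (fun k => ((continuous_smoothedIncrement hT L s t I g (hpos k).ne').measurable.comp
        hZA).aestronglyMeasurable) (integrable_const _)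
      (fun k => Eventually.of_forall fun ω => abs_smoothedIncrement_le hT hL s t I hg _ _)
      (Eventually.of_forall fun ω => ?_)
    have := tendsto_smoothedIncrement hT L s t I g (DCirc.mk (Z ω) (A ω))
    simp only [DUp.extend_coe] at this
    exact this
  exact le_of_tendsto' h.abs fun k => abs_integral_smoothedIncrement_limit_le hT hmart hAst hconv
    hL (by exact_mod_cast hst) I (fun i hi => by exact_mod_cast hI i hi) hg (hpos k)

theorem abs_comp_apply_le_pathSup (hT : 0 ≤ T) (φ : C(ℝ≥0, ℝ)) (τ : DUp T) (t : Icc (0 : ℝ) T) :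
    |φ (τ t)| ≤ pathSup hT (DCirc.mk φ τ) := le_supNorm φ (τ.2.2 t.2.2)

theorem integral_prod_mul_sub_eq_zero (hT : 0 ≤ T)
    (hZA : Measurable fun ω => DCirc.mk (Z ω) (A ω))
    (hmart : ∀ n, Martingale (fun t ω => Zn n ω t) (𝓕 n) (P n))
    (hAst : ∀ n t, IsStoppingTime (𝓕 n) (fun ω => ((An n ω t : ℝ≥0) : WithTop ℝ≥0)))
    (hconv : TendstoInDistribution (fun n ω => DCirc.mk (Zn n ω) (An n ω)) atTop
      (fun ω => DCirc.mk (Z ω) (A ω)) P P')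
    (hS : Integrable (fun ω => pathSup hT (DCirc.mk (Z ω) (A ω))) P')
    {s t : Icc (0 : ℝ) T} (hst : s ≤ t) (I : Finset (Icc (0 : ℝ) T))
    (hI : ∀ i ∈ I, i ≤ s) {g : Icc (0 : ℝ) T → C(ℝ, ℝ)} (hg : ∀ i x, |g i x| ≤ 1) :
    ∫ ω, (∏ i ∈ I, g i (Z ω (A ω i))) * (Z ω (A ω t) - Z ω (A ω s)) ∂P' = 0 := by
  have hM := measurable_comp_apply hT hZA
  set S : Ω' → ℝ := fun ω => pathSup hT (DCirc.mk (Z ω) (A ω)) with hSdef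
  have hS0 : ∀ ω, 0 ≤ S ω := fun ω => pathSup_nonneg hT _
  have hMS : ∀ r ω, |Z ω (A ω r)| ≤ S ω := fun r ω => abs_comp_apply_le_pathSup hT _ _ r
  have h1 : Tendsto (fun L : ℕ => ∫ ω, (∏ i ∈ I, g i (Z ω (A ω i))) *
      (truncate L (Z ω (A ω t)) - truncate L (Z ω (A ω s))) ∂P') atTop
      (𝓝 (∫ ω, (∏ i ∈ I, g i (Z ω (A ω i))) * (Z ω (A ω t) - Z ω (A ω s)) ∂P')) := by
    refine tendsto_integral_of_dominated_convergence (fun ω => 2 * S ω) (fun L => ?_)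
      (hS.const_mul 2) (fun L => Eventually.of_forall fun ω => ?_)
      (Eventually.of_forall fun ω => ?_)
    · refine (Measurable.mul (Finset.measurable_prod _ fun i _ =>
        (g i).continuous.measurable.comp (hM i)) (Measurable.sub ?_ ?_)).aestronglyMeasurable
      · exact (continuous_truncate _).measurable.comp (hM t)
      · exact (continuous_truncate _).measurable.comp (hM s)
    · have h2 := (abs_truncate_le_abs (Nat.cast_nonneg L) (Z ω (A ω t))).trans (hMS t ω)
      have h3 := (abs_truncate_le_abs (Nat.cast_nonneg L) (Z ω (A ω s))).trans (hMS s ω)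
      have h4 := abs_sub (truncate L (Z ω (A ω t))) (truncate L (Z ω (A ω s)))
      rw [Real.norm_eq_abs, abs_mul, Finset.abs_prod]
      calc _ ≤ 1 * (2 * S ω) := mul_le_mul
            (Finset.prod_le_one (fun _ _ => abs_nonneg _) fun i _ => hg i _) (by linarith)
            (abs_nonneg _) zero_le_one
        _ = 2 * S ω := one_mul _
    · refine Tendsto.congr' ?_ tendsto_const_nhds
      filter_upwards [tendsto_natCast_atTop_atTop.eventually_ge_atTop (S ω)] with L hL
      rw [truncate_eq_self ((hMS t ω).trans hL), truncate_eq_self ((hMS s ω).trans hL)]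
  -- Here integrability of `S` removes the truncation error: `L * ramp L (S ω)` is at most `S ω + 1`
  -- and vanishes once `L ≥ S ω + 1`.
  have h2 : Tendsto (fun L : ℕ => 4 * ∫ ω, (L : ℝ) * ramp L (S ω) ∂P') atTop (𝓝 0) := by
    have : Tendsto (fun L : ℕ => ∫ ω, (L : ℝ) * ramp L (S ω) ∂P') atTop
        (𝓝 (∫ _, (0 : ℝ) ∂P')) := by
      refine tendsto_integral_of_dominated_convergence (fun ω => S ω + 1) (fun L => ?_)
        (hS.add (integrable_const 1)) (fun L => Eventually.of_forall fun ω => ?_)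
        (Eventually.of_forall fun ω => ?_)
      · exact ((continuous_ramp L).comp_aestronglyMeasurable hS.1).const_mul _
      · rw [Real.norm_eq_abs, abs_of_nonneg (mul_nonneg (Nat.cast_nonneg L) (ramp_nonneg _ _))]
        exact mul_ramp_le (Nat.cast_nonneg L) (hS0 ω)
      · refine Tendsto.congr' ?_ tendsto_const_nhds
        filter_upwards [tendsto_natCast_atTop_atTop.eventually_ge_atTop (S ω + 1)] with L hL
        rw [ramp_eq_zero (by linarith), mul_zero]
    simpa using this.const_mul 4
  refine abs_eq_zero.1 (le_antisymm (le_of_tendsto_of_tendsto' h1.abs h2 fun L => ?_)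
    (abs_nonneg _))
  refine (abs_integral_prod_mul_truncate_sub_le hT hZA hmart hAst hconv (Nat.cast_nonneg L)
    hst I hI hg).trans_eq ?_
  rw [integral_const_mul, mul_assoc]

end Limit

theorem mainTheorem9 (T : ℝ) (hT : 0 < T)
    {Ω : ℕ → Type*} {mΩ : ∀ n, MeasurableSpace (Ω n)}
    (P : ∀ n, Measure (Ω n)) [∀ n, IsProbabilityMeasure (P n)]
    (𝓕 : ∀ n, Filtration ℝ≥0 (mΩ n))
    (Zn : ∀ n, Ω n → C(ℝ≥0, ℝ)) (An : ∀ n, Ω n → DUp T)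
    {Ω' : Type*} [MeasurableSpace Ω'] (P' : Measure Ω') [IsProbabilityMeasure P']
    (Z : Ω' → C(ℝ≥0, ℝ)) (A : Ω' → DUp T)
    (hZA : Measurable fun ω => DCirc.mk (Z ω) (A ω))
    (hmart : ∀ n, Martingale (fun t ω => Zn n ω t) (𝓕 n) (P n))
    (hAst : ∀ n t, IsStoppingTime (𝓕 n) (fun ω => ((An n ω t : ℝ≥0) : WithTop ℝ≥0)))
    (hzero : ∀ n, ∀ᵐ ω ∂(P n), An n ω ⟨0, left_mem_Icc.2 hT.le⟩ = 0)
    (hjump : ∀ ε : ℝ, 0 < ε →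
      Tendsto (fun n => P n {ω | ∃ t, ε < (An n ω).jump t}) atTop (𝓝 0))
    (hconv : TendstoInDistribution (fun n ω => DCirc.mk (Zn n ω) (An n ω)) atTop
      (fun ω => DCirc.mk (Z ω) (A ω)) P P')
    (hbound : (⨆ n, ∫⁻ ω, ⨆ t : Icc (0 : ℝ) T, ‖Zn n ω (An n ω t)‖ₑ ∂(P n)) < ∞) :
    IsMartingaleOwnFiltration (fun (t : Icc (0 : ℝ) T) ω => Z ω (A ω t)) P' ∧
      ∫⁻ ω, ⨆ s : Iic (A ω ⟨T, right_mem_Icc.2 hT.le⟩), ‖Z ω (s : ℝ≥0)‖ₑ ∂P' < ∞ := by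
  have hle := (lintegral_pathSup_le hT.le hZA hzero hjump hconv).trans_lt hbound
  have hS : Integrable (fun ω => pathSup hT.le (DCirc.mk (Z ω) (A ω))) P' := by
    refine ⟨((continuous_pathSup hT.le).measurable.comp hZA).aestronglyMeasurable, ?_⟩
    rwa [hasFiniteIntegral_iff_ofReal (Eventually.of_forall fun ω => pathSup_nonneg hT.le _)]
  have hM := measurable_comp_apply hT.le hZA
  refine ⟨isMartingaleOwnFiltration_of_forall_integral_prod_mul_eq_zero
    (fun t => (hM t).stronglyMeasurable) (fun t => hS.mono' (hM t).aestronglyMeasurable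
      (Eventually.of_forall fun ω => abs_comp_apply_le_pathSup hT.le _ _ t))
    fun s t hst I hI g hg =>
      integral_prod_mul_sub_eq_zero hT.le hZA hmart hAst hconv hS hst I hI hg, ?_⟩
  simp_rw [iSup_enorm_eq_supNorm]
  exact hle
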